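/- Let $\mathcal{A}$ be a finite set, $F_{\mathcal{A}}$ the free group on $\mathcal{A}$, $\mathcal{A}^*$ the set of finite words over $\mathcal{A}$ (including the empty word), regarded as a subset of $F_{\mathcal{A}}$, and $\mathcal{A}^+$ the set of nonempty words. A shift space is a subset $X\subseteq\mathcal{A}^{\mathbb{Z}}$ that is closed in the product topology (with $\mathcal{A}$ discrete) and invariant under the shift; it is minimal if it is nonempty and contains no nonempty shift space other than itself. Let $\mathcal{L}(X)\subseteq\mathcal{A}^*$ be the set of all finite blocks (including the empty word) occurring in elements of $X$. For $w\in\mathcal{L}(X)$, let \[ \mathcal{R}_X(w)=\{r\in\mathcal{A}^+ \mid rw\in(\mathcal{L}(X)\cap w\mathcal{A}^*)\setminus\mathcal{A}^+w\mathcal{A}^+\} \] be the set of (left) return words to $w$. The extension graph of $w$ is the bipartite graph whose vertex set is the disjoint union of $\{a\in\mathcal{A}\mid aw\in\mathcal{L}(X)\}$ and $\{b\in\mathcal{A}\mid wb\in\mathcal{L}(X)\}$, with an edge between $a$ in the first set and $b$ in the second if and only if $awb\in\mathcal{L}(X)$. The shift space $X$ is dendric if the extension graph of every $w\in\mathcal{L}(X)$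 is a tree. Let $X$ be a minimal shift space over $\mathcal{A}$ such that, for every $w\in\mathcal{L}(X)$, $\mathcal{R}_X(w)$ is a basis of the free group $F_{\mathcal{A}}$. Then $X$ is dendric. -/

import Mathlib

open SymbolicDynamics.FullShift

namespace ShiftSpace

/-- A shift space is minimal if it is nonempty and contains no nonempty shift space other than
itself. -/
def IsMinimal {A : Type*} [TopologicalSpace A] (X : Subshift A ℤ) : Prop :=
  X.carrier.Nonempty ∧
    ∀ Y : Subshift A ℤ, Y.carrier.Nonempty → Y.carrier ⊆ X.carrier → Y.carrier = X.carrier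

/-- The language of `X`: all finite words `x i, x (i+1), …, x (i+n-1)` read in points `x` of `X`.
The case `n = 0` gives the empty word. -/
def language {A : Type*} [TopologicalSpace A] (X : Subshift A ℤ) : Set (List A) :=
  {w | ∃ x ∈ X.carrier, ∃ (i : ℤ) (n : ℕ), w = List.ofFn (fun k : Fin n => x (i + (k : ℤ)))}

/-- The (left) return words to `w`: the nonempty words `r` such that `r w` is in the language,
begins with `w`, and has no occurrence of `w` that is neither a prefix nor a suffix. -/
def returnWords {A : Type*} [TopologicalSpace A] (X : Subshift A ℤ) (w : List A) :
    Set (List A) :=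
  {r | r ≠ [] ∧ r ++ w ∈ language X ∧ (∃ t, r ++ w = w ++ t) ∧
    ¬ ∃ p s : List A, p ≠ [] ∧ s ≠ [] ∧ r ++ w = p ++ w ++ s}

/-- The canonical embedding of words into the free group. -/
def toFreeGroup {A : Type*} (w : List A) : FreeGroup A :=
  (w.map FreeGroup.of).prod

/-- A subset `S` of a group `G` is a basis of `G` if `G` is free on `S`. -/
def IsBasis {G : Type*} [Group G] (S : Set G) : Prop :=
  ∃ b : FreeGroupBasis S G, ∀ s : S, b s = (s : G)

/-- Letters `a` such that `a w` is in the language. -/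
def leftExt {A : Type*} [TopologicalSpace A] (X : Subshift A ℤ) (w : List A) : Set A :=
  {a | a :: w ∈ language X}

/-- Letters `b` such that `w b` is in the language. -/
def rightExt {A : Type*} [TopologicalSpace A] (X : Subshift A ℤ) (w : List A) : Set A :=
  {b | w ++ [b] ∈ language X}

/-- Pairs of letters `(a, b)` such that `a w b` is in the language. -/
def biExt {A : Type*} [TopologicalSpace A] (X : Subshift A ℤ) (w : List A) : Set (A × A) :=
  {p | p.1 :: (w ++ [p.2]) ∈ language X}

/-- The extension graph of `w`: the bipartite graph on the disjoint union of the left and the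
right extensions, with an edge between `a` on the left and `b` on the right when `a w b` is in
the language. -/
def extensionGraph {A : Type*} [TopologicalSpace A] (X : Subshift A ℤ) (w : List A) :
    SimpleGraph (leftExt X w ⊕ rightExt X w) where
  Adj u v :=
    (∃ (a : leftExt X w) (b : rightExt X w),
      u = Sum.inl a ∧ v = Sum.inr b ∧ ((a : A), (b : A)) ∈ biExt X w) ∨
    (∃ (a : leftExt X w) (b : rightExt X w),
      v = Sum.inl a ∧ u = Sum.inr b ∧ ((a : A), (b : A)) ∈ biExt X w)
  symm := ⟨fun _ _ h => h.symm⟩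
  loopless := ⟨by
    rintro u (⟨a, b, h, h', -⟩ | ⟨a, b, h, h', -⟩) <;> · rw [h] at h'; cases h'⟩

/-- A shift space is dendric if the extension graph of each word of its language is a tree. -/
def IsDendric {A : Type*} [TopologicalSpace A] (X : Subshift A ℤ) : Prop :=
  ∀ w ∈ language X, (extensionGraph X w).IsTree

end ShiftSpace

/-! Fix a point `x` of `X`; by minimality its words are the whole language. A locally determined map
`f` on `ℤ` with finite range is viewed as a finite graph through which `x` runs: the edge at time
`i` goes from `f i` to `f (i + 1)` with label `x i`. Choose a word `w` whose occurrences are more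
than `g` apart. The initial graph is a segment of length `g` spelling a prefix of `w`, closed up by
the return words to `w`. Its rank (edges minus vertices plus one) is at most the number of return
words, which is the number of letters, and the extension graphs of its paths of length less than `g`
are stars. Stallings folds lead from it to the one-vertex graph, whose paths are the words of `x`;
the extension graphs have to remain trees along the way.

While there are two vertices, some fold identifies edges `e`, `e'` that can follow the same
arbitrarily long paths (`exists_isFoldable`), up to reversal of time. This rests on
`exists_lifts_agree`: if the lifts of `w` at the two ends of a word `r w` always determined each
other, return words would permute the lifts of `w`. Freeness extends this to an action of the free
group, and return words to a longer word, which generate, force the lift to be unique.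

A fold removes one vertex, and since the rank never drops below the number of letters
(`ncard_range_add_card_le`), it removes exactly one edge. Each new extension graph is then an old
tree, possibly with two vertices having a common neighbour identified, or two such trees glued at a
vertex (`IsFold.isTreeRel`). If no suitable `w` exists, `x` is periodic, and there is a single
return word, hence a single letter. -/

namespace ShiftSpace

/-! ### Finite bipartite trees as edge relations. -/

section BipartiteRelations

variable {α β α' β' : Type*}

/-- One step between edges of a bipartite relation that share an endpoint. -/
def EdgeAdj (B : Set (α × β)) (u v : α × β) : Prop :=
  v ∈ B ∧ (u.1 = v.1 ∨ u.2 = v.2)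

/-- Any two edges of `B` are joined by a chain of edges of `B` with common endpoints. -/
def EdgeConnected (B : Set (α × β)) : Prop :=
  ∀ u ∈ B, ∀ v ∈ B, Relation.ReflTransGen (EdgeAdj B) u v

/-- The bipartite graph with edge set `B`, on the two projections of `B`, is a finite tree. -/
structure IsTreeRel (B : Set (α × β)) : Prop where
  finite : B.Finite
  nonempty : B.Nonempty
  connected : EdgeConnected B
  card_le : B.ncard + 1 ≤ (Prod.fst '' B).ncard + (Prod.snd '' B).ncard

/-- The bipartite graph on `L ⊕ R` with edge relation `B`. -/
def bipartiteGraph (L : Set α) (R : Set β) (B : Set (α × β)) : SimpleGraph (L ⊕ R) where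
  Adj u v :=
    (∃ (a : L) (b : R), u = Sum.inl a ∧ v = Sum.inr b ∧ ((a : α), (b : β)) ∈ B) ∨
    (∃ (a : L) (b : R), v = Sum.inl a ∧ u = Sum.inr b ∧ ((a : α), (b : β)) ∈ B)
  symm := ⟨fun _ _ h => h.symm⟩
  loopless := ⟨by
    rintro u (⟨a, b, h, h', -⟩ | ⟨a, b, h, h', -⟩) <;> · rw [h] at h'; cases h'⟩

theorem bipartiteGraph_connected {L : Set α} {R : Set β} {B : Set (α × β)}
    (hL : Prod.fst '' B = L) (hR : Prod.snd '' B = R) (hne : B.Nonempty)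
    (hB : EdgeConnected B) : (bipartiteGraph L R B).Connected := by
  subst hL hR
  set G := bipartiteGraph (Prod.fst '' B) (Prod.snd '' B) B
  have hadj : ∀ p (hp : p ∈ B), G.Adj (Sum.inl ⟨p.1, p, hp, rfl⟩) (Sum.inr ⟨p.2, p, hp, rfl⟩) :=
    fun p hp => Or.inl ⟨_, _, rfl, rfl, hp⟩
  obtain ⟨p₀, hp₀⟩ := hne
  have key : ∀ p, Relation.ReflTransGen (EdgeAdj B) p₀ p → ∃ hp : p ∈ B,
      G.Reachable (Sum.inl ⟨p₀.1, p₀, hp₀, rfl⟩) (Sum.inl ⟨p.1, p, hp, rfl⟩) := by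
    intro p h
    induction h with
    | refl => exact ⟨hp₀, SimpleGraph.Reachable.refl _⟩
    | @tail u v _ huv ih =>
      obtain ⟨hu, ih⟩ := ih
      obtain ⟨hv, h | h⟩ := huv
      · refine ⟨hv, ?_⟩
        have e : (⟨u.1, u, hu, rfl⟩ : Prod.fst '' B) = ⟨v.1, v, hv, rfl⟩ := Subtype.ext h
        rwa [e] at ih
      · refine ⟨hv, ih.trans ((hadj u hu).reachable.trans ?_)⟩
        have e : (⟨u.2, u, hu, rfl⟩ : Prod.snd '' B) = ⟨v.2, v, hv, rfl⟩ := Subtype.ext h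
        rw [e]
        exact (hadj v hv).symm.reachable
  have hall : ∀ z, G.Reachable (Sum.inl ⟨p₀.1, p₀, hp₀, rfl⟩) z := by
    rintro (⟨a, p, hp, rfl⟩ | ⟨b, p, hp, rfl⟩)
    · exact (key p (hB _ hp₀ _ hp)).2
    · exact (key p (hB _ hp₀ _ hp)).2.trans (hadj p hp).reachable
  have : Nonempty (↑(Prod.fst '' B) ⊕ ↑(Prod.snd '' B)) := ⟨Sum.inl ⟨p₀.1, p₀, hp₀, rfl⟩⟩
  exact ⟨fun u v => (hall u).symm.trans (hall v)⟩

theorem card_edgeSet_bipartiteGraph {L : Set α} {R : Set β} {B : Set (α × β)}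
    (hL : Prod.fst '' B = L) (hR : Prod.snd '' B = R) :
    Nat.card (bipartiteGraph L R B).edgeSet = B.ncard := by
  subst hL hR
  set G := bipartiteGraph (Prod.fst '' B) (Prod.snd '' B) B
  rw [← Nat.card_coe_set_eq]
  symm
  refine Nat.card_congr (Equiv.ofBijective
    (fun p : B => (⟨s(Sum.inl ⟨p.1.1, p.1, p.2, rfl⟩, Sum.inr ⟨p.1.2, p.1, p.2, rfl⟩), by
      rw [SimpleGraph.mem_edgeSet]
      exact Or.inl ⟨_, _, rfl, rfl, p.2⟩⟩ : G.edgeSet)) ⟨?_, ?_⟩)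
  · rintro ⟨⟨a, b⟩, hp⟩ ⟨⟨c, d⟩, hq⟩ h
    simpa [Subtype.ext_iff] using h
  · rintro ⟨e, he⟩
    induction e using Sym2.ind with
    | _ u v =>
      rw [SimpleGraph.mem_edgeSet] at he
      rcases he with ⟨a, b, rfl, rfl, h⟩ | ⟨a, b, rfl, rfl, h⟩
      · exact ⟨⟨_, h⟩, rfl⟩
      · exact ⟨⟨_, h⟩, by simp [Sym2.eq_swap]⟩

theorem card_sum_coe {L : Set α} {R : Set β} (hL : L.Finite) (hR : R.Finite) :
    Nat.card (L ⊕ R) = L.ncard + R.ncard := by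
  have := hL.to_subtype
  have := hR.to_subtype
  rw [Nat.card_sum, Nat.card_coe_set_eq, Nat.card_coe_set_eq]

theorem EdgeConnected.ncard_add_ncard_le {B : Set (α × β)} (hfin : B.Finite) (hne : B.Nonempty)
    (hB : EdgeConnected B) :
    (Prod.fst '' B).ncard + (Prod.snd '' B).ncard ≤ B.ncard + 1 := by
  have h := (bipartiteGraph_connected rfl rfl hne hB).card_vert_le_card_edgeSet_add_one
  rwa [card_edgeSet_bipartiteGraph rfl rfl, card_sum_coe (hfin.image _) (hfin.image _)] at h

/-- Connectedness gives the inequality opposite to `card_le`, so the edges number exactly one less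
than the vertices. -/
theorem IsTreeRel.isTree {L : Set α} {R : Set β} {B : Set (α × β)} (hB : IsTreeRel B)
    (hL : Prod.fst '' B = L) (hR : Prod.snd '' B = R) : (bipartiteGraph L R B).IsTree := by
  have hLf : L.Finite := hL ▸ hB.finite.image _
  have hRf : R.Finite := hR ▸ hB.finite.image _
  have := hLf.to_subtype
  have := hRf.to_subtype
  rw [SimpleGraph.isTree_iff_connected_and_card]
  refine ⟨bipartiteGraph_connected hL hR hB.nonempty hB.connected, ?_⟩
  rw [card_edgeSet_bipartiteGraph hL hR, card_sum_coe hLf hRf]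
  have h₁ := hB.card_le
  have h₂ := hB.connected.ncard_add_ncard_le hB.finite hB.nonempty
  rw [hL, hR] at h₁ h₂
  omega

/-- Chains of edges, unlike adjacency within a fixed vertex type, are carried along by arbitrary
maps on the two sides. -/
theorem EdgeConnected.image {B : Set (α × β)} (hB : EdgeConnected B) (g : α → α') (h : β → β') :
    EdgeConnected (Prod.map g h '' B) := by
  rintro _ ⟨u, hu, rfl⟩ _ ⟨v, hv, rfl⟩
  refine Relation.ReflTransGen.lift (Prod.map g h) ?_ _ _ (hB u hu v hv)
  rintro a b ⟨hb, hab⟩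
  exact ⟨⟨b, hb, rfl⟩, hab.imp (fun e => by simp [e]) (fun e => by simp [e])⟩

theorem fst_image_prodMap (B : Set (α × β)) (g : α → α') (h : β → β') :
    Prod.fst '' (Prod.map g h '' B) = g '' (Prod.fst '' B) := by
  simp [Set.image_image]

theorem snd_image_prodMap (B : Set (α × β)) (g : α → α') (h : β → β') :
    Prod.snd '' (Prod.map g h '' B) = h '' (Prod.snd '' B) := by
  simp [Set.image_image]

theorem IsTreeRel.image {B : Set (α × β)} (hB : IsTreeRel B) {g : α → α'} {h : β → β'}
    (hg : Set.InjOn g (Prod.fst '' B)) (hh : Set.InjOn h (Prod.snd '' B)) :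
    IsTreeRel (Prod.map g h '' B) where
  finite := hB.finite.image _
  nonempty := hB.nonempty.image _
  connected := hB.connected.image g h
  card_le := by
    rw [fst_image_prodMap, snd_image_prodMap, hg.ncard_image,
      hh.ncard_image]
    have := Set.ncard_image_le (f := Prod.map g h) hB.finite
    have := hB.card_le
    omega

/-- Identifying two right vertices with a common neighbour preserves trees. -/
theorem IsTreeRel.image_merge {B : Set (α × β)} (hB : IsTreeRel B) {g : α → α'} {h : β → β'}
    (hg : Set.InjOn g (Prod.fst '' B)) {e e' : β} {c : α} (hne : e ≠ e') (he : (c, e) ∈ B)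
    (he' : (c, e') ∈ B) (hee : h e = h e') (hh : Set.InjOn h (Prod.snd '' B \ {e'})) :
    IsTreeRel (Prod.map g h '' B) where
  finite := hB.finite.image _
  nonempty := hB.nonempty.image _
  connected := hB.connected.image g h
  card_le := by
    rw [fst_image_prodMap, snd_image_prodMap, hg.ncard_image]
    -- The edges to `e` and `e'` from the common neighbour `c` become one, which pays for the lost
    -- vertex.
    have h₁ : Prod.map g h '' B ⊆ Prod.map g h '' (B \ {(c, e')}) := by
      rintro _ ⟨p, hp, rfl⟩
      by_cases hpc : p = (c, e')
      · exact ⟨(c, e), ⟨he, by simp [hne]⟩, by simp [hpc, hee]⟩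
      · exact ⟨p, ⟨hp, hpc⟩, rfl⟩
    have h₂ := Set.ncard_le_ncard h₁ ((hB.finite.sdiff).image _)
    have h₃ := Set.ncard_image_le (f := Prod.map g h) (hB.finite.sdiff (t := {(c, e')}))
    have h₄ := Set.ncard_sdiff_singleton_add_one he' hB.finite
    have hR := hB.finite.image Prod.snd
    have h₅ : (h '' (Prod.snd '' B \ {e'})).ncard ≤ (h '' (Prod.snd '' B)).ncard :=
      Set.ncard_le_ncard (Set.image_mono Set.sdiff_subset) (hR.image _)
    rw [hh.ncard_image] at h₅
    have he₂ : e' ∈ Prod.snd '' B := ⟨_, he', rfl⟩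
    have h₆ := Set.ncard_sdiff_singleton_add_one he₂ hR
    have := hB.card_le
    omega

/-- In a tree, two right vertices have at most one common neighbour. -/
theorem IsTreeRel.common_neighbor_unique {B : Set (α × β)} (hB : IsTreeRel B) {e e' : β}
    {c c' : α} (hne : e ≠ e') (h₁ : (c, e) ∈ B) (h₂ : (c, e') ∈ B) (h₃ : (c', e) ∈ B)
    (h₄ : (c', e') ∈ B) : c = c' := by
  classical
  by_contra hcc
  -- Identifying `e'` with `e` would lose one vertex but two edges, too many for the image to stay
  -- connected.
  set h : β → β := fun b => if b = e' then e else b with hh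
  have hhe' : h e' = e := by simp [hh]
  have hhe : ∀ b, b ≠ e' → h b = b := fun b hb => by simp [hh, hb]
  have hsub : Prod.map id h '' B ⊆ Prod.map id h '' (B \ {(c, e'), (c', e')}) := by
    rintro _ ⟨p, hp, rfl⟩
    by_cases hpc : p = (c, e')
    · exact ⟨(c, e), ⟨h₁, by simp [hne]⟩, by simp [hpc, hhe', hhe e hne]⟩
    by_cases hpc' : p = (c', e')
    · exact ⟨(c', e), ⟨h₃, by simp [hne]⟩, by simp [hpc', hhe', hhe e hne]⟩
    · exact ⟨p, ⟨hp, by simp [hpc, hpc']⟩, rfl⟩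
  have k₁ := Set.ncard_le_ncard hsub ((hB.finite.sdiff).image _)
  have k₂ := Set.ncard_image_le (f := Prod.map (id : α → α) h)
    (hB.finite.sdiff (t := {(c, e'), (c', e')}))
  have k₃ := Set.ncard_sdiff_add_ncard_of_subset
    (s := {(c, e'), (c', e')}) (t := B) (by simp [Set.insert_subset_iff, h₂, h₄]) hB.finite
  rw [Set.ncard_pair (by simpa using hcc)] at k₃
  have k₄ := (hB.connected.image id h).ncard_add_ncard_le (hB.finite.image _)
    (hB.nonempty.image _)
  rw [fst_image_prodMap, snd_image_prodMap, Set.image_id] at k₄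
  have hR := hB.finite.image Prod.snd
  have k₅ : (h '' (Prod.snd '' B \ {e'})).ncard ≤ (h '' (Prod.snd '' B)).ncard :=
    Set.ncard_le_ncard (Set.image_mono Set.sdiff_subset) (hR.image _)
  rw [Set.InjOn.ncard_image (fun x hx y hy hxy => by
    rwa [hhe x hx.2, hhe y hy.2] at hxy)] at k₅
  have he₂ : e' ∈ Prod.snd '' B := ⟨_, h₂, rfl⟩
  have k₆ := Set.ncard_sdiff_singleton_add_one he₂ hR
  have := hB.card_le
  omega

/-- Two trees glued along a single left vertex form a tree. -/
theorem IsTreeRel.union {B₁ B₂ : Set (α × β)} (hB₁ : IsTreeRel B₁) (hB₂ : IsTreeRel B₂) {c : α}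
    (hL : Prod.fst '' B₁ ∩ Prod.fst '' B₂ = {c})
    (hR : Disjoint (Prod.snd '' B₁) (Prod.snd '' B₂)) : IsTreeRel (B₁ ∪ B₂) where
  finite := hB₁.finite.union hB₂.finite
  nonempty := hB₁.nonempty.inl
  connected := by
    have hc : c ∈ Prod.fst '' B₁ ∩ Prod.fst '' B₂ := by rw [hL]; rfl
    obtain ⟨⟨p, hp, hpc⟩, ⟨q, hq, hqc⟩⟩ := hc
    have m₁ : ∀ u v, Relation.ReflTransGen (EdgeAdj B₁) u v →
        Relation.ReflTransGen (EdgeAdj (B₁ ∪ B₂)) u v := fun u v h =>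
      Relation.ReflTransGen.mono (fun a b hab => ⟨Or.inl hab.1, hab.2⟩) _ _ h
    have m₂ : ∀ u v, Relation.ReflTransGen (EdgeAdj B₂) u v →
        Relation.ReflTransGen (EdgeAdj (B₁ ∪ B₂)) u v := fun u v h =>
      Relation.ReflTransGen.mono (fun a b hab => ⟨Or.inr hab.1, hab.2⟩) _ _ h
    have pq : Relation.ReflTransGen (EdgeAdj (B₁ ∪ B₂)) p q :=
      Relation.ReflTransGen.single ⟨Or.inr hq, Or.inl (hpc.trans hqc.symm)⟩
    have qp : Relation.ReflTransGen (EdgeAdj (B₁ ∪ B₂)) q p :=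
      Relation.ReflTransGen.single ⟨Or.inl hp, Or.inl (hqc.trans hpc.symm)⟩
    rintro u (hu | hu) v (hv | hv)
    · exact m₁ _ _ (hB₁.connected u hu v hv)
    · exact (m₁ _ _ (hB₁.connected u hu p hp)).trans
        (pq.trans (m₂ _ _ (hB₂.connected q hq v hv)))
    · exact (m₂ _ _ (hB₂.connected u hu q hq)).trans
        (qp.trans (m₁ _ _ (hB₁.connected p hp v hv)))
    · exact m₂ _ _ (hB₂.connected u hu v hv)
  card_le := by
    rw [Set.image_union, Set.image_union]
    have h₁ := Set.ncard_union_le B₁ B₂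
    have h₂ := Set.ncard_union_add_ncard_inter (Prod.fst '' B₁) (Prod.fst '' B₂)
      (hB₁.finite.image _) (hB₂.finite.image _)
    rw [hL, Set.ncard_singleton] at h₂
    have h₃ := Set.ncard_union_eq hR (hB₁.finite.image _) (hB₂.finite.image _)
    have := hB₁.card_le
    have := hB₂.card_le
    omega

theorem isTreeRel_of_fst_eq {B : Set (α × β)} (hfin : B.Finite) (hne : B.Nonempty)
    (h : ∀ u ∈ B, ∀ v ∈ B, u.1 = v.1) : IsTreeRel B where
  finite := hfin
  nonempty := hne
  connected := fun u hu v hv => Relation.ReflTransGen.single ⟨hv, Or.inl (h u hu v hv)⟩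
  card_le := by
    have h₁ : (Prod.snd '' B).ncard = B.ncard := Set.InjOn.ncard_image
      fun u hu v hv huv => Prod.ext (h u hu v hv) huv
    have h₂ := (Set.ncard_pos (hfin.image Prod.fst)).2 (hne.image _)
    omega

theorem isTreeRel_of_snd_eq {B : Set (α × β)} (hfin : B.Finite) (hne : B.Nonempty)
    (h : ∀ u ∈ B, ∀ v ∈ B, u.2 = v.2) : IsTreeRel B where
  finite := hfin
  nonempty := hne
  connected := fun u hu v hv => Relation.ReflTransGen.single ⟨hv, Or.inr (h u hu v hv)⟩
  card_le := by
    have h₁ : (Prod.fst '' B).ncard = B.ncard := Set.InjOn.ncard_image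
      fun u hu v hv huv => Prod.ext huv (h u hu v hv)
    have h₂ := (Set.ncard_pos (hfin.image Prod.snd)).2 (hne.image _)
    omega

theorem isTreeRel_swap {B : Set (α × β)} (hB : IsTreeRel B) :
    IsTreeRel (Prod.swap '' B) where
  finite := hB.finite.image _
  nonempty := hB.nonempty.image _
  connected := by
    rintro _ ⟨u, hu, rfl⟩ _ ⟨v, hv, rfl⟩
    refine Relation.ReflTransGen.lift Prod.swap ?_ _ _ (hB.connected u hu v hv)
    rintro a b ⟨hb, hab⟩
    exact ⟨⟨b, hb, rfl⟩, hab.symm⟩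
  card_le := by
    have h₁ : Prod.fst '' (Prod.swap '' B) = Prod.snd '' B := by simp [Set.image_image]
    have h₂ : Prod.snd '' (Prod.swap '' B) = Prod.fst '' B := by simp [Set.image_image]
    rw [h₁, h₂, Set.ncard_image_of_injective _ Prod.swap_injective]
    have := hB.card_le
    omega

end BipartiteRelations

/-! ### Extension graphs of paths in a graph, and their behaviour under a fold. -/

section Folding

variable {V T V' T' : Type*}

/-- The positions `i` and `j` carry the same path of length `n`, where a bi-infinite path is given
by its vertices `f` and its edges `E`. -/
def SameWindow (f : ℤ → V) (E : ℤ → T) (n : ℕ) (i j : ℤ) : Prop :=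
  f j = f i ∧ ∀ k : ℕ, k < n → E (j + k) = E (i + k)

/-- The pairs of edges which can surround the path of length `n` starting at position `i`. -/
def extRel (f : ℤ → V) (E : ℤ → T) (n : ℕ) (i : ℤ) : Set (T × T) :=
  {p | ∃ j, SameWindow f E n i j ∧ p = (E (j - 1), E (j + n))}

/-- Edges determine their endpoints. -/
def Coherent (f : ℤ → V) (E : ℤ → T) : Prop :=
  ∀ i j, E i = E j → f i = f j ∧ f (i + 1) = f (j + 1)

theorem SameWindow.symm {f : ℤ → V} {E : ℤ → T} {n : ℕ} {i j : ℤ} (h : SameWindow f E n i j) :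
    SameWindow f E n j i :=
  ⟨h.1.symm, fun k hk => (h.2 k hk).symm⟩

theorem SameWindow.trans {f : ℤ → V} {E : ℤ → T} {n : ℕ} {i j l : ℤ} (h : SameWindow f E n i j)
    (h' : SameWindow f E n j l) : SameWindow f E n i l :=
  ⟨h'.1.trans h.1, fun k hk => (h'.2 k hk).trans (h.2 k hk)⟩

theorem sameWindow_succ {f : ℤ → V} {E : ℤ → T} {n : ℕ} {i j : ℤ} :
    SameWindow f E (n + 1) i j ↔ SameWindow f E n i j ∧ E (j + n) = E (i + n) := by
  constructor
  · rintro ⟨h₁, h₂⟩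
    exact ⟨⟨h₁, fun k hk => h₂ k (by omega)⟩, h₂ n (by omega)⟩
  · rintro ⟨⟨h₁, h₂⟩, h₃⟩
    refine ⟨h₁, fun k hk => ?_⟩
    rcases Nat.lt_succ_iff_lt_or_eq.1 hk with hk | rfl
    · exact h₂ k hk
    · exact h₃

/-- Prolongs a window on the left; coherence is what recovers the vertices from the first edge. -/
theorem sameWindow_succ' {f : ℤ → V} {E : ℤ → T} (hc : Coherent f E) {n : ℕ} {i j : ℤ} :
    SameWindow f E (n + 1) i j ↔ E j = E i ∧ SameWindow f E n (i + 1) (j + 1) := by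
  constructor
  · rintro ⟨-, h₂⟩
    have h₀ : E j = E i := by simpa using h₂ 0 (by omega)
    refine ⟨h₀, (hc _ _ h₀).2, fun k hk => ?_⟩
    have := h₂ (k + 1) (by omega)
    push_cast at this
    rwa [add_assoc, add_assoc, add_comm 1 (k : ℤ)]
  · rintro ⟨h₀, -, h₂⟩
    refine ⟨(hc _ _ h₀).1, fun k hk => ?_⟩
    rcases k with _ | k
    · simpa using h₀
    · have := h₂ k (by omega)
      push_cast
      rwa [add_assoc, add_assoc, add_comm 1 (k : ℤ)] at this

/-- `(f', E')` arises from `(f, E)` by identifying two edges `e`, `e'` with the same origin `p`,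
and accordingly their distinct targets `q` and `q'`. Moreover `e` and `e'` can follow the same
arbitrarily long paths. -/
structure IsFold (f : ℤ → V) (E : ℤ → T) (f' : ℤ → V') (E' : ℤ → T') (h : T → T') (e e' : T)
    (p q q' : V) : Prop where
  coherent : Coherent f E
  map_edge : ∀ i, E' i = h (E i)
  edge_eq : ∀ i j, h (E i) = h (E j) →
    E i = E j ∨ (E i = e ∧ E j = e') ∨ (E i = e' ∧ E j = e)
  map_eq : h e = h e'
  vertex_eq : ∀ i j, f' i = f' j ↔ f i = f j ∨ (f i = q ∧ f j = q') ∨ (f i = q' ∧ f j = q)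
  ne : q ≠ q'
  left : ∀ i, E i = e → f i = p ∧ f (i + 1) = q
  right : ∀ i, E i = e' → f i = p ∧ f (i + 1) = q'
  long : ∀ m : ℕ, ∃ a b, E a = e ∧ E b = e' ∧ ∀ k : ℕ, k < m → E (a - 1 - k) = E (b - 1 - k)

namespace IsFold

variable {f : ℤ → V} {E : ℤ → T} {f' : ℤ → V'} {E' : ℤ → T'} {h : T → T'} {e e' : T}
  {p q q' : V}

theorem edge_ne (H : IsFold f E f' E' h e e' p q q') : e ≠ e' := by
  rintro rfl
  obtain ⟨a, b, ha, hb, -⟩ := H.long 0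
  exact H.ne ((H.left a ha).2.symm.trans (H.right a ha).2)

/-- The positions `a`, `b` from `long` have a common past ending in `e` and `e'`. Reading backwards,
this past must be the given path: at each stage the edge of the path and the edge of the past are
both common neighbours of `e` and `e'` in a tree, hence equal. The next edge of the past is the
common neighbour. -/
theorem exists_common (H : IsFold f E f' E' h e e' p q q') {g : ℕ}
    (ht : ∀ n < g, ∀ i, IsTreeRel (extRel f E n i)) {n : ℕ} (hn : n < g) {i j₁ j₂ : ℤ}
    (h₁ : SameWindow f E n i j₁) (h₂ : SameWindow f E n i j₂) (he : E (j₁ + n) = e)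
    (he' : E (j₂ + n) = e') : ∃ c, (c, e) ∈ extRel f E n i ∧ (c, e') ∈ extRel f E n i := by
  obtain ⟨a, b, ha, hb, hab⟩ := H.long (g + 1)
  have key : ∀ n, n < g → ∀ i j₁ j₂, SameWindow f E n i j₁ → SameWindow f E n i j₂ →
      E (j₁ + n) = e → E (j₂ + n) = e' →
      SameWindow f E n i (a - n) ∧ SameWindow f E n i (b - n) := by
    intro n
    induction n with
    | zero =>
      intro _ i j₁ j₂ h₁ _ he _
      have hp : f i = p := by rw [← h₁.1]; exact (H.left _ (by simpa using he)).1
      exact ⟨⟨by simp [hp, (H.left a ha).1], by simp⟩, ⟨by simp [hp, (H.right b hb).1], by simp⟩⟩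
    | succ n ih =>
      intro hn i j₁ j₂ h₁ h₂ he he'
      rw [sameWindow_succ' H.coherent] at h₁ h₂
      push_cast at he he'
      rw [add_comm (n : ℤ) 1, ← add_assoc] at he he'
      obtain ⟨ka, kb⟩ := ih (by omega) _ _ _ h₁.2 h₂.2 he he'
      have hE := hab n (by omega)
      have e₁ : a - ((n + 1 : ℕ) : ℤ) = a - 1 - n := by push_cast; ring
      have e₂ : b - ((n + 1 : ℕ) : ℤ) = b - 1 - n := by push_cast; ring
      have e₃ : a - 1 - (n : ℤ) + 1 = a - n := by ring
      have e₄ : b - 1 - (n : ℤ) + 1 = b - n := by ring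
      have hu := (ht n (by omega) (i + 1)).common_neighbor_unique H.edge_ne (c := E i)
        (c' := E (a - 1 - n)) ⟨j₁ + 1, h₁.2, by simp [h₁.1, he]⟩ ⟨j₂ + 1, h₂.2, by simp [h₂.1, he']⟩
        ⟨a - n, ka, by simp [ha, sub_right_comm]⟩
        ⟨b - n, kb, by rw [hE, sub_right_comm, sub_add_cancel, hb]⟩
      rw [e₁, e₂, sameWindow_succ' H.coherent, sameWindow_succ' H.coherent, e₃, e₄, ← hE]
      exact ⟨⟨hu.symm, ka⟩, ⟨hu.symm, kb⟩⟩
  obtain ⟨ka, kb⟩ := key n hn i j₁ j₂ h₁ h₂ he he'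
  refine ⟨E (a - 1 - n), ⟨_, ka, by simp [ha, sub_right_comm]⟩,
    ⟨_, kb, by rw [hab n (by omega), sub_right_comm, sub_add_cancel, hb]⟩⟩

/-- Edges entering a given vertex are not identified, because `e` and `e'` have distinct targets. On
the right, `e` and `e'` may both occur, and then `exists_common` supplies the neighbour needed to
merge them. -/
theorem isTreeRel_map (H : IsFold f E f' E' h e e' p q q') {g : ℕ}
    (ht : ∀ n < g, ∀ i, IsTreeRel (extRel f E n i)) {n : ℕ} (hn : n < g) (i : ℤ) :
    IsTreeRel (Prod.map h h '' extRel f E n i) := by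
  have hL : Set.InjOn h (Prod.fst '' extRel f E n i) := by
    rintro _ ⟨_, ⟨j₁, hj₁, rfl⟩, rfl⟩ _ ⟨_, ⟨j₂, hj₂, rfl⟩, rfl⟩ hh
    have hf : f j₁ = f j₂ := hj₁.1.trans hj₂.1.symm
    rcases H.edge_eq _ _ hh with h₁ | ⟨h₁, h₂⟩ | ⟨h₁, h₂⟩
    · exact h₁
    · have k₁ := (H.left _ h₁).2
      have k₂ := (H.right _ h₂).2
      rw [sub_add_cancel] at k₁ k₂
      exact absurd (k₁.symm.trans (hf.trans k₂)) H.ne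
    · have k₁ := (H.right _ h₁).2
      have k₂ := (H.left _ h₂).2
      rw [sub_add_cancel] at k₁ k₂
      exact absurd (k₂.symm.trans (hf.symm.trans k₁)) H.ne
  by_cases hb : (∃ j, SameWindow f E n i j ∧ E (j + n) = e) ∧
      ∃ j, SameWindow f E n i j ∧ E (j + n) = e'
  · obtain ⟨⟨j₁, h₁, he⟩, ⟨j₂, h₂, he'⟩⟩ := hb
    obtain ⟨c, hc, hc'⟩ := H.exists_common ht hn h₁ h₂ he he'
    refine (ht n hn i).image_merge hL H.edge_ne hc hc' H.map_eq ?_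
    rintro _ ⟨⟨_, ⟨k₁, hk₁, rfl⟩, rfl⟩, hne₁⟩ _ ⟨⟨_, ⟨k₂, hk₂, rfl⟩, rfl⟩, hne₂⟩ hh
    rcases H.edge_eq _ _ hh with h₁ | ⟨h₁, h₂⟩ | ⟨h₁, h₂⟩
    · exact h₁
    · exact absurd h₂ hne₂
    · exact absurd h₁ hne₁
  · refine (ht n hn i).image hL ?_
    rintro _ ⟨_, ⟨k₁, hk₁, rfl⟩, rfl⟩ _ ⟨_, ⟨k₂, hk₂, rfl⟩, rfl⟩ hh
    rcases H.edge_eq _ _ hh with h₁ | ⟨h₁, h₂⟩ | ⟨h₁, h₂⟩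
    · exact h₁
    · exact absurd ⟨⟨_, hk₁, h₁⟩, ⟨_, hk₂, h₂⟩⟩ hb
    · exact absurd ⟨⟨_, hk₂, h₂⟩, ⟨_, hk₁, h₁⟩⟩ hb

/-- A folded path determines its original except for its last edge: the origin of the following edge
tells whether `e` or `e'` was used. -/
theorem sameWindow_succ_iff (H : IsFold f E f' E' h e e' p q q') {n : ℕ} {i j : ℤ} :
    SameWindow f' E' (n + 1) i j ↔ SameWindow f E n i j ∧ h (E (j + n)) = h (E (i + n)) := by
  have hf : ∀ i j, h (E i) = h (E j) → f i = f j := by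
    intro i j hh
    rcases H.edge_eq _ _ hh with h₁ | ⟨h₁, h₂⟩ | ⟨h₁, h₂⟩
    · exact (H.coherent _ _ h₁).1
    · rw [(H.left _ h₁).1, (H.right _ h₂).1]
    · rw [(H.right _ h₁).1, (H.left _ h₂).1]
  constructor
  · rintro ⟨-, h₂⟩
    simp only [H.map_edge] at h₂
    refine ⟨⟨hf _ _ (by simpa using h₂ 0 (by omega)), fun k hk => ?_⟩, h₂ n (by omega)⟩
    have hn : f (j + k + 1) = f (i + k + 1) := by
      have := hf _ _ (h₂ (k + 1) (by omega))
      push_cast at this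
      rwa [← add_assoc, ← add_assoc] at this
    rcases H.edge_eq _ _ (h₂ k (by omega)) with h₁ | ⟨h₁, h₂⟩ | ⟨h₁, h₂⟩
    · exact h₁
    · rw [(H.left _ h₁).2, (H.right _ h₂).2] at hn
      exact absurd hn H.ne
    · rw [(H.right _ h₁).2, (H.left _ h₂).2] at hn
      exact absurd hn.symm H.ne
  · rintro ⟨⟨h₁, h₂⟩, h₃⟩
    refine ⟨(H.vertex_eq _ _).2 (Or.inl h₁), fun k hk => ?_⟩
    rw [H.map_edge, H.map_edge]
    rcases Nat.lt_succ_iff_lt_or_eq.1 hk with hk | rfl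
    · rw [h₂ k hk]
    · exact h₃

theorem extRel_eq_of_iff (H : IsFold f E f' E' h e e' p q q') {n : ℕ} {i : ℤ}
    (hw : ∀ j, SameWindow f' E' n i j ↔ SameWindow f E n i j) :
    extRel f' E' n i = Prod.map h h '' extRel f E n i := by
  ext u
  constructor
  · rintro ⟨j, hj, rfl⟩
    exact ⟨_, ⟨j, (hw j).1 hj, rfl⟩, by simp [H.map_edge]⟩
  · rintro ⟨_, ⟨j, hj, rfl⟩, rfl⟩
    exact ⟨j, (hw j).2 hj, by simp [H.map_edge]⟩

theorem extRel_eq_union (H : IsFold f E f' E' h e e' p q q') {n : ℕ} {i i₁ i₂ : ℤ}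
    (hw : ∀ j, SameWindow f' E' n i j ↔ SameWindow f E n i₁ j ∨ SameWindow f E n i₂ j) :
    extRel f' E' n i = Prod.map h h '' extRel f E n i₁ ∪ Prod.map h h '' extRel f E n i₂ := by
  ext u
  constructor
  · rintro ⟨j, hj, rfl⟩
    exact ((hw j).1 hj).imp (fun hj => ⟨_, ⟨j, hj, rfl⟩, by simp [H.map_edge]⟩)
      (fun hj => ⟨_, ⟨j, hj, rfl⟩, by simp [H.map_edge]⟩)
  · rintro (⟨_, ⟨j, hj, rfl⟩, rfl⟩ | ⟨_, ⟨j, hj, rfl⟩, rfl⟩)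
    · exact ⟨j, (hw j).2 (Or.inl hj), by simp [H.map_edge]⟩
    · exact ⟨j, (hw j).2 (Or.inr hj), by simp [H.map_edge]⟩

/-- Right extensions of paths ending in `q` and in `q'` remain distinct after the fold. -/
theorem disjoint_snd (H : IsFold f E f' E' h e e' p q q') {n : ℕ} {i₁ i₂ : ℤ}
    (h₁ : ∀ j, SameWindow f E n i₁ j → f (j + n) = q)
    (h₂ : ∀ j, SameWindow f E n i₂ j → f (j + n) = q') :
    Disjoint (Prod.snd '' (Prod.map h h '' extRel f E n i₁))
      (Prod.snd '' (Prod.map h h '' extRel f E n i₂)) := by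
  rw [Set.disjoint_left]
  rintro _ ⟨_, ⟨_, ⟨j, hj, rfl⟩, rfl⟩, rfl⟩ ⟨_, ⟨_, ⟨l, hl, rfl⟩, rfl⟩, hh⟩
  have k₁ := h₁ j hj
  have k₂ := h₂ l hl
  rcases H.edge_eq _ _ hh with h₁ | ⟨h₁, h₂⟩ | ⟨h₁, h₂⟩
  · have := (H.coherent _ _ h₁).1
    exact H.ne (k₁.symm.trans (this.symm.trans k₂))
  · have := (H.left _ h₁).1.trans (H.right _ h₂).1.symm
    exact H.ne (k₁.symm.trans (this.symm.trans k₂))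
  · have := (H.right _ h₁).1.trans (H.left _ h₂).1.symm
    exact H.ne (k₁.symm.trans (this.symm.trans k₂))

/-- At the merged vertex, the trees of `q` and `q'` are glued at their only common left neighbour,
the folded edge. The other vertices keep their tree up to `h`. -/
theorem isTreeRel_zero (H : IsFold f E f' E' h e e' p q q') {g : ℕ} (hg : 0 < g)
    (ht : ∀ n < g, ∀ i, IsTreeRel (extRel f E n i)) (i : ℤ) :
    IsTreeRel (extRel f' E' 0 i) := by
  by_cases hi : f i = q ∨ f i = q'
  · obtain ⟨a, b, ha, hb, -⟩ := H.long 0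
    have hfa := (H.left a ha).2
    have hfb := (H.right b hb).2
    rw [H.extRel_eq_union (i₁ := a + 1) (i₂ := b + 1)]
    · refine (H.isTreeRel_map ht hg _).union (H.isTreeRel_map ht hg _) (c := h e) ?_
        (H.disjoint_snd ?_ ?_)
      · ext c
        constructor
        · rintro ⟨⟨_, ⟨_, ⟨j, hj, rfl⟩, rfl⟩, rfl⟩, ⟨_, ⟨_, ⟨l, hl, rfl⟩, rfl⟩, hh⟩⟩
          have hfj : f j = q := hj.1.trans hfa
          have hfl : f l = q' := hl.1.trans hfb
          rcases H.edge_eq _ _ hh with h₁ | ⟨h₁, h₂⟩ | ⟨h₁, h₂⟩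
          · have := (H.coherent _ _ h₁).2
            rw [sub_add_cancel, sub_add_cancel, hfj, hfl] at this
            exact absurd this.symm H.ne
          · have := (H.left _ h₁).2
            rw [sub_add_cancel, hfl] at this
            exact absurd this.symm H.ne
          · simp [h₂]
        · rintro rfl
          refine ⟨⟨_, ⟨_, ⟨a + 1, ⟨rfl, by simp⟩, rfl⟩, rfl⟩, by simp [ha]⟩,
            ⟨_, ⟨_, ⟨b + 1, ⟨rfl, by simp⟩, rfl⟩, rfl⟩, by simp [hb, H.map_eq]⟩⟩
      · intro j hj
        simpa [hfa] using hj.1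
      · intro j hj
        simpa [hfb] using hj.1
    · intro j
      simp only [SameWindow, H.vertex_eq, Nat.not_lt_zero, false_imp_iff, implies_true, and_true,
        hfa, hfb]
      rcases hi with hi | hi <;> rw [hi]
      · simp [H.ne]
      · simp [H.ne.symm, or_comm]
  · rw [H.extRel_eq_of_iff]
    · exact H.isTreeRel_map ht hg i
    · intro j
      push Not at hi
      simp [SameWindow, H.vertex_eq, hi.1, hi.2]

/-- A folded path ending in the folded edge comes from two paths, ending in `e` and `e'`, when both
exist. Their trees share exactly one left vertex: existence is `exists_common`, uniqueness is
`common_neighbor_unique` for the path without its last edge. -/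
theorem isTreeRel_succ (H : IsFold f E f' E' h e e' p q q') {g n : ℕ} (hg : n + 1 < g)
    (ht : ∀ n < g, ∀ i, IsTreeRel (extRel f E n i)) (i : ℤ) :
    IsTreeRel (extRel f' E' (n + 1) i) := by
  by_cases hi : (∃ j, SameWindow f E n i j ∧ E (j + n) = e) ∧
      (∃ j, SameWindow f E n i j ∧ E (j + n) = e') ∧ (E (i + n) = e ∨ E (i + n) = e')
  · obtain ⟨⟨a, ha, hae⟩, ⟨b, hb, hbe⟩, hi⟩ := hi
    have hea : ∀ j, SameWindow f E (n + 1) a j ↔ SameWindow f E n i j ∧ E (j + n) = e := by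
      intro j
      rw [sameWindow_succ, hae]
      exact ⟨fun hj => ⟨ha.trans hj.1, hj.2⟩, fun hj => ⟨ha.symm.trans hj.1, hj.2⟩⟩
    have heb : ∀ j, SameWindow f E (n + 1) b j ↔ SameWindow f E n i j ∧ E (j + n) = e' := by
      intro j
      rw [sameWindow_succ, hbe]
      exact ⟨fun hj => ⟨hb.trans hj.1, hj.2⟩, fun hj => ⟨hb.symm.trans hj.1, hj.2⟩⟩
    rw [H.extRel_eq_union (i₁ := a) (i₂ := b)]
    · obtain ⟨c, ⟨j₁, hj₁, hc₁⟩, ⟨j₂, hj₂, hc₂⟩⟩ := H.exists_common ht (by omega) ha hb hae hbe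
      rw [Prod.mk.injEq] at hc₁ hc₂
      refine (H.isTreeRel_map ht hg _).union (H.isTreeRel_map ht hg _) (c := h c) ?_
        (H.disjoint_snd ?_ ?_)
      · ext d
        constructor
        · rintro ⟨⟨_, ⟨_, ⟨j, hj, rfl⟩, rfl⟩, rfl⟩, ⟨_, ⟨_, ⟨l, hl, rfl⟩, rfl⟩, hh⟩⟩
          rw [hea] at hj
          rw [heb] at hl
          have hfjl : f j = f l := hj.1.1.trans hl.1.1.symm
          have hE : E (l - 1) = E (j - 1) := by
            rcases H.edge_eq _ _ hh with h₁ | ⟨h₁, h₂⟩ | ⟨h₁, h₂⟩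
            · exact h₁
            · have k₁ := (H.left _ h₁).2
              have k₂ := (H.right _ h₂).2
              rw [sub_add_cancel] at k₁ k₂
              exact absurd (k₁.symm.trans (hfjl.symm.trans k₂)) H.ne
            · have k₁ := (H.right _ h₁).2
              have k₂ := (H.left _ h₂).2
              rw [sub_add_cancel] at k₁ k₂
              exact absurd (k₂.symm.trans (hfjl.trans k₁)) H.ne
          have := (ht n (by omega) i).common_neighbor_unique H.edge_ne (c := E (j - 1)) (c' := c)
            ⟨j, hj.1, by rw [hj.2]⟩ ⟨l, hl.1, by rw [hl.2, hE]⟩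
            ⟨j₁, hj₁, by rw [← hc₁.1, ← hc₁.2]⟩ ⟨j₂, hj₂, by rw [← hc₂.1, ← hc₂.2]⟩
          simp [this]
        · rintro rfl
          exact ⟨⟨_, ⟨_, ⟨j₁, (hea j₁).2 ⟨hj₁, hc₁.2.symm⟩, rfl⟩, rfl⟩, by simp [hc₁.1]⟩,
            ⟨_, ⟨_, ⟨j₂, (heb j₂).2 ⟨hj₂, hc₂.2.symm⟩, rfl⟩, rfl⟩, by simp [hc₂.1]⟩⟩
      · intro j hj
        have := (H.left _ ((hea j).1 hj).2).2
        push_cast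
        rwa [← add_assoc]
      · intro j hj
        have := (H.right _ ((heb j).1 hj).2).2
        push_cast
        rwa [← add_assoc]
    · intro j
      rw [H.sameWindow_succ_iff, hea, heb, ← and_or_left]
      refine and_congr_right fun _ => ?_
      constructor
      · intro hh
        rcases H.edge_eq _ _ hh with h₁ | ⟨h₁, h₂⟩ | ⟨h₁, h₂⟩
        · rwa [h₁]
        · exact Or.inl h₁
        · exact Or.inr h₁
      · rintro (hj | hj) <;> rcases hi with hi | hi <;> simp [hj, hi, H.map_eq]
  · rw [H.extRel_eq_of_iff]
    · exact H.isTreeRel_map ht hg i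
    · intro j
      rw [H.sameWindow_succ_iff, sameWindow_succ]
      refine and_congr_right fun hj => ⟨fun hh => ?_, fun hh => by rw [hh]⟩
      rcases H.edge_eq _ _ hh with h₁ | ⟨h₁, h₂⟩ | ⟨h₁, h₂⟩
      · exact h₁
      · exact absurd ⟨⟨j, hj, h₁⟩, ⟨i, ⟨rfl, fun _ _ => rfl⟩, h₂⟩, Or.inr h₂⟩ hi
      · exact absurd ⟨⟨i, ⟨rfl, fun _ _ => rfl⟩, h₂⟩, ⟨j, hj, h₁⟩, Or.inl h₂⟩ hi

theorem isTreeRel (H : IsFold f E f' E' h e e' p q q') {g : ℕ}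
    (ht : ∀ n < g, ∀ i, IsTreeRel (extRel f E n i)) :
    ∀ n < g, ∀ i, IsTreeRel (extRel f' E' n i)
  | 0, hg, i => H.isTreeRel_zero hg ht i
  | _ + 1, hg, i => H.isTreeRel_succ hg ht i

end IsFold

/-- Time reversal reduces folds of edges with a common target to folds of edges with a common
origin. -/
theorem extRel_reverse (f : ℤ → V) (E : ℤ → T) (hc : Coherent f E) (n : ℕ) (i : ℤ) :
    extRel (fun k => f (-k)) (fun k => E (-1 - k)) n i = Prod.swap '' extRel f E n (-i - n) := by
  have key : ∀ j, SameWindow (fun k => f (-k)) (fun k => E (-1 - k)) n i j ↔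
      SameWindow f E n (-i - n) (-j - n) := by
    intro j
    -- For `n = 0` only the vertex counts; for positive length the edges determine the vertex by
    -- coherence.
    rcases n with _ | n
    · simp [SameWindow]
    constructor
    · rintro ⟨-, h⟩
      have h' : ∀ k : ℕ, k < n + 1 → E (-j - (n + 1 : ℕ) + k) = E (-i - (n + 1 : ℕ) + k) := by
        intro k hk
        have := h (n - k) (by omega)
        rw [Nat.cast_sub (by omega)] at this
        convert this using 2 <;> push_cast <;> ring
      exact ⟨(hc _ _ (by simpa using h' 0 (by omega))).1, h'⟩
    · rintro ⟨-, h⟩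
      have h' : ∀ k : ℕ, k < n + 1 → E (-1 - (j + k)) = E (-1 - (i + k)) := by
        intro k hk
        have := h (n - k) (by omega)
        rw [Nat.cast_sub (by omega)] at this
        convert this using 2 <;> push_cast <;> ring
      refine ⟨?_, h'⟩
      have := (hc _ _ (h' 0 (by omega))).2
      have e : ∀ l : ℤ, -1 - (l + (0 : ℕ)) + 1 = -l := fun l => by push_cast; ring
      rwa [e, e] at this
  ext ⟨u, v⟩
  constructor
  · rintro ⟨j, hj, hp⟩
    rw [Prod.mk.injEq] at hp
    refine ⟨(v, u), ⟨-j - n, (key j).1 hj, ?_⟩, rfl⟩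
    rw [hp.1, hp.2, Prod.mk.injEq]
    constructor <;> ring_nf
  · rintro ⟨_, ⟨j, hj, rfl⟩, hp⟩
    rw [Prod.swap_prod_mk, Prod.mk.injEq] at hp
    refine ⟨-j - n, (key _).2 (by simpa using hj), ?_⟩
    rw [← hp.1, ← hp.2, Prod.mk.injEq]
    constructor <;> ring_nf

end Folding

/-! ### Bases of free groups and positive words. -/

section FreeBases

variable {A G H : Type*} [Group G] [Group H]

theorem IsBasis.exists_hom {S : Set G} (hS : IsBasis S) (u : S → H) :
    ∃ φ : G →* H, ∀ s : S, φ s = u s := by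
  obtain ⟨b, hb⟩ := hS
  refine ⟨(FreeGroup.lift u).comp b.repr.toMonoidHom, fun s => ?_⟩
  have := b.repr_apply_coe s
  rw [hb s] at this
  simp [this]

theorem IsBasis.mem_of_subset {S : Set G} (hS : IsBasis S) {K : Subgroup G}
    (h : ∀ s ∈ S, s ∈ K) (g : G) : g ∈ K := by
  obtain ⟨b, hb⟩ := hS
  obtain ⟨w, rfl⟩ := b.repr.symm.surjective g
  have hx : ∀ s : S, b.repr.symm (FreeGroup.of s) ∈ K := fun s => by
    have : b.repr.symm (FreeGroup.of s) = (s : G) := hb s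
    rw [this]
    exact h s s.2
  induction w using FreeGroup.induction_on with
  | C1 => simp [K.one_mem]
  | of s => exact hx s
  | inv_of s _ => rw [map_inv]; exact K.inv_mem (hx s)
  | mul v w hv hw => rw [map_mul]; exact K.mul_mem hv hw

theorem IsBasis.card_eq {S : Set (FreeGroup A)} (hS : IsBasis S) : Nat.card S = Nat.card A := by
  obtain ⟨b, -⟩ := hS
  exact (Nat.card_congr (Equiv.ofFreeGroupEquiv b.repr)).symm

theorem toFreeGroup_append (v w : List A) :
    toFreeGroup (v ++ w) = toFreeGroup v * toFreeGroup w := by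
  simp [toFreeGroup]

/-- A positive word contains no cancelling pair, so it is its own reduced form. -/
theorem toFreeGroup_injective : Function.Injective (toFreeGroup : List A → FreeGroup A) := by
  classical
  have key : ∀ w : List A, (toFreeGroup w).toWord = w.map fun a => (a, true) := by
    intro w
    have h₁ : toFreeGroup w = FreeGroup.mk (w.map fun a => (a, true)) := by
      induction w with
      | nil => rfl
      | cons a w ih =>
        have : toFreeGroup (a :: w) = FreeGroup.of a * toFreeGroup w := by simp [toFreeGroup]
        rw [this, ih]
        rfl
    rw [h₁, FreeGroup.toWord_mk]
    refine FreeGroup.IsReduced.reduce_eq ?_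
    rw [FreeGroup.IsReduced, List.isChain_map]
    exact List.Pairwise.isChain (List.pairwise_of_forall (by simp))
  intro v w h
  have := congrArg FreeGroup.toWord h
  rw [key, key] at this
  exact List.map_injective_iff.2 (fun a b hab => by simpa using hab) this

/-- Provides a potential on all of `ℤ`: the product of `c` along an interval becomes `(g s)⁻¹ * g (s
+ d)`. -/
theorem exists_cocycle (c : ℤ → G) : ∃ g : ℤ → G, ∀ i, g (i + 1) = g i * c i := by
  let P : ℕ → G := fun n => Nat.rec 1 (fun k u => u * c k) n
  let N : ℕ → G := fun n => Nat.rec 1 (fun k u => u * (c (-(k + 1)))⁻¹) n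
  have hP : ∀ n, P (n + 1) = P n * c n := fun n => rfl
  have hN : ∀ n, N (n + 1) = N n * (c (-(n + 1)))⁻¹ := fun n => rfl
  refine ⟨fun i => if 0 ≤ i then P i.toNat else N (-i).toNat, fun i => ?_⟩
  rcases le_or_gt 0 i with hi | hi
  · obtain ⟨n, rfl⟩ := Int.eq_ofNat_of_zero_le hi
    have h₁ : (0 : ℤ) ≤ (n : ℤ) + 1 := by omega
    have h₂ : ((n : ℤ) + 1).toNat = n + 1 := by omega
    simp [h₁, h₂, hP]
  · obtain ⟨n, rfl⟩ : ∃ n : ℕ, i = -((n : ℤ) + 1) := ⟨(-i - 1).toNat, by omega⟩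
    have h₁ : ¬ (0 : ℤ) ≤ -((n : ℤ) + 1) := by omega
    have h₂ : (-(-((n : ℤ) + 1))).toNat = n + 1 := by omega
    simp only [h₁, if_false, h₂, hN, inv_mul_cancel_right]
    rcases n with _ | n
    · simp [P, N]
    · have h₃ : ¬ (0 : ℤ) ≤ -(((n + 1 : ℕ) : ℤ) + 1) + 1 := by omega
      have h₄ : (-(-(((n + 1 : ℕ) : ℤ) + 1) + 1)).toNat = n + 1 := by omega
      rw [if_neg h₃, h₄]

end FreeBases

/-- The hypothesis defines a bijection between the ranges of `a` and `b`, and in a finite set such a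
partial bijection extends to a permutation. -/
theorem exists_perm_of_eq_iff {I M : Type*} [Finite M] (a b : I → M)
    (h : ∀ i j, a i = a j ↔ b i = b j) : ∃ σ : Equiv.Perm M, ∀ i, σ (a i) = b i := by
  classical
  let e₀ : {m // m ∈ Set.range a} → {m // m ∈ Set.range b} := fun m => ⟨b m.2.choose, _, rfl⟩
  have he₀ : ∀ i, e₀ ⟨a i, i, rfl⟩ = ⟨b i, i, rfl⟩ := fun i =>
    Subtype.ext ((h _ _).1 (⟨i, rfl⟩ : a i ∈ Set.range a).choose_spec)
  have hbij : Function.Bijective e₀ := by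
    constructor
    · rintro ⟨_, i, rfl⟩ ⟨_, j, rfl⟩ hij
      rw [he₀, he₀] at hij
      exact Subtype.ext ((h i j).2 (congrArg Subtype.val hij))
    · rintro ⟨_, i, rfl⟩
      exact ⟨_, he₀ i⟩
  have := Fintype.ofFinite M
  refine ⟨(Equiv.ofBijective e₀ hbij).extendSubtype, fun i => ?_⟩
  rw [Equiv.extendSubtype_apply_of_mem _ _ ⟨i, rfl⟩, Equiv.ofBijective_apply, he₀]

/-! ### Occurrences, return words and ambiguous lifts. -/

section Words

variable {A : Type*}

/-- The word of length `d` read at position `t` of `x`. -/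
def wordAt (x : ℤ → A) (t : ℤ) (d : ℕ) : List A :=
  List.ofFn fun k : Fin d => x (t + (k : ℤ))

/-- The word of length `L` at position `t` of `x` also occurs at position `s`. -/
def Occ (x : ℤ → A) (t : ℤ) (L : ℕ) (s : ℤ) : Prop :=
  ∀ k : ℕ, k < L → x (s + k) = x (t + k)

/-- The positions `s` and `s + d` are consecutive occurrences of the word of length `L` at
position `t` of `x`. -/
def IsReturn (x : ℤ → A) (t : ℤ) (L : ℕ) (s : ℤ) (d : ℕ) : Prop :=
  0 < d ∧ Occ x t L s ∧ Occ x t L (s + d) ∧ ∀ k : ℕ, 0 < k → k < d → ¬ Occ x t L (s + k)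

/-- The words between consecutive occurrences of the word of length `L` at position `t`. -/
def returnSet (x : ℤ → A) (t : ℤ) (L : ℕ) : Set (List A) :=
  {r | ∃ s d, IsReturn x t L s d ∧ r = wordAt x s d}

/-- `f i` depends only on a bounded window of `x` around `i`. -/
def IsLocal {V : Type*} (x : ℤ → A) (f : ℤ → V) : Prop :=
  ∃ m : ℕ, ∀ i j, (∀ k : ℤ, -m ≤ k → k ≤ m → x (j + k) = x (i + k)) → f j = f i

theorem length_wordAt (x : ℤ → A) (t : ℤ) (d : ℕ) : (wordAt x t d).length = d := by
  simp [wordAt]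

theorem wordAt_eq_iff {x : ℤ → A} {s t : ℤ} {d : ℕ} :
    wordAt x s d = wordAt x t d ↔ ∀ k : ℕ, k < d → x (s + k) = x (t + k) := by
  rw [wordAt, wordAt, List.ofFn_inj, funext_iff]
  exact ⟨fun h k hk => h ⟨k, hk⟩, fun h k => h k k.2⟩

theorem wordAt_add (x : ℤ → A) (t : ℤ) (d d' : ℕ) :
    wordAt x t (d + d') = wordAt x t d ++ wordAt x (t + d) d' := by
  rw [wordAt, List.ofFn_add]
  simp [wordAt, add_assoc]

theorem toFreeGroup_wordAt {x : ℤ → A} {g : ℤ → FreeGroup A}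
    (hg : ∀ i, g (i + 1) = g i * FreeGroup.of (x i)) (t : ℤ) (d : ℕ) :
    toFreeGroup (wordAt x t d) = (g t)⁻¹ * g (t + d) := by
  induction d with
  | zero => simp [wordAt, toFreeGroup]
  | succ d ih =>
    have h₁ : toFreeGroup (wordAt x (t + d) 1) = FreeGroup.of (x (t + d)) := by
      simp [wordAt, toFreeGroup]
    rw [wordAt_add, toFreeGroup_append, ih, h₁]
    push_cast
    rw [← add_assoc, hg, mul_assoc]

/-- Any two occurrences are joined by a chain of consecutive ones. -/
theorem eq_of_forall_isReturn {γ : Type*} {x : ℤ → A} {t : ℤ} {L : ℕ} (c : ℤ → γ)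
    (h : ∀ s d, IsReturn x t L s d → c s = c (s + d)) {s s' : ℤ} (hs : Occ x t L s)
    (hs' : Occ x t L s') : c s = c s' := by
  classical
  have key : ∀ n : ℕ, ∀ s, Occ x t L s → Occ x t L (s + n) → c s = c (s + n) := by
    intro n
    induction n using Nat.strong_induction_on with
    | _ n ih =>
      intro s hs hn
      rcases Nat.eq_zero_or_pos n with rfl | hpos
      · simp
      have hex : ∃ k : ℕ, 0 < k ∧ Occ x t L (s + k) := ⟨n, hpos, hn⟩
      obtain ⟨hd, hocc⟩ := Nat.find_spec hex
      have hle : Nat.find hex ≤ n := Nat.find_min' hex ⟨hpos, hn⟩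
      have hr : IsReturn x t L s (Nat.find hex) :=
        ⟨hd, hs, hocc, fun k hk hk' ho => Nat.find_min hex hk' ⟨hk, ho⟩⟩
      have e : s + (Nat.find hex : ℤ) + ((n - Nat.find hex : ℕ) : ℤ) = s + n := by
        rw [Nat.cast_sub hle]; ring
      rw [h _ _ hr, ih (n - Nat.find hex) (by omega) _ hocc (by rwa [e]), e]
  rcases le_total s s' with hle | hle
  · obtain ⟨n, hn⟩ := Int.eq_ofNat_of_zero_le (sub_nonneg.2 hle)
    obtain rfl : s' = s + n := by omega
    exact key n s hs hs'
  · obtain ⟨n, hn⟩ := Int.eq_ofNat_of_zero_le (sub_nonneg.2 hle)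
    obtain rfl : s = s' + n := by omega
    exact (key n s' hs' hs).symm

/-- If some word of `x` can be lifted along `f` in two ways, then so can some word of the form
`r w`, with two lifts that agree along `w` as a suffix, or along `w` as a prefix. -/
theorem exists_lifts_agree {V : Type*} {x : ℤ → A} {f : ℤ → V} (hfin : (Set.range f).Finite)
    (hloc : IsLocal x f) (hb : ∀ t L, IsBasis (toFreeGroup '' returnSet x t L)) (L : ℕ) {i j : ℤ}
    (hij : Occ x i L j) (hne : ∃ k : ℕ, k ≤ L ∧ f (i + k) ≠ f (j + k)) :
    ∃ i j, ∃ d : ℕ, 0 < d ∧ (∀ k : ℕ, k < d + L → x (i + k) = x (j + k)) ∧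
      ((∀ k : ℕ, k ≤ L → f (i + k) = f (j + k)) ∧ (∃ k : ℕ, k ≤ L ∧ f (i + d + k) ≠ f (j + d + k)) ∨
      (∃ k : ℕ, k ≤ L ∧ f (i + k) ≠ f (j + k)) ∧ (∀ k : ℕ, k ≤ L → f (i + d + k) = f (j + d + k)))
    := by
  classical
  by_contra hcon
  push Not at hcon
  set t := i with ht
  let l : ℤ → Fin (L + 1) → V := fun s k => f (s + (k : ℤ))
  have hl : ∀ s s', l s = l s' ↔ ∀ k : ℕ, k ≤ L → f (s + k) = f (s' + k) := by
    intro s s'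
    rw [funext_iff]
    exact ⟨fun h k hk => h ⟨k, by omega⟩, fun h k => h k (by omega)⟩
  have hMfin : (Set.range l).Finite := by
    refine (Set.Finite.pi (fun _ : Fin (L + 1) => hfin)).subset ?_
    rintro _ ⟨s, rfl⟩ k _
    exact ⟨_, rfl⟩
  have : Finite (Set.range l) := hMfin
  let m : ℤ → Set.range l := fun s => ⟨l s, s, rfl⟩
  have hm : ∀ s s', m s = m s' ↔ l s = l s' := fun s s' => Subtype.ext_iff
  -- By the negated conclusion, the lifts of the two end copies of `w` in `r w` determine each
  -- other, so each return word acts as a partial bijection on the finite set of lifts.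
  have hret : ∀ s s' d, IsReturn x t L s d → IsReturn x t L s' d → wordAt x s d = wordAt x s' d →
      (m (s + d) = m (s' + d) ↔ m s = m s') := by
    intro s s' d hs hs' hw
    rw [hm, hm, hl, hl]
    have hx : ∀ k : ℕ, k < d + L → x (s + k) = x (s' + k) := by
      intro k hk
      rcases lt_or_ge k d with hkd | hkd
      · exact wordAt_eq_iff.1 hw k hkd
      · obtain ⟨k, rfl⟩ := Nat.exists_eq_add_of_le hkd
        push_cast
        rw [← add_assoc, ← add_assoc, hs.2.2.1 k (by omega), hs'.2.2.1 k (by omega)]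
    obtain ⟨h₁, h₂⟩ := hcon s s' d hs.1 hx
    constructor
    · intro h
      by_contra h'
      push Not at h'
      obtain ⟨k, hk, hk'⟩ := h₂ h'
      exact hk' (h k hk)
    · exact h₁
  have hperm : ∀ r : List A, ∃ σ : Equiv.Perm (Set.range l), ∀ s d, IsReturn x t L s d →
      wordAt x s d = r → σ (m (s + d)) = m s := by
    intro r
    obtain ⟨σ, hσ⟩ := exists_perm_of_eq_iff
      (I := {p : ℤ × ℕ // IsReturn x t L p.1 p.2 ∧ wordAt x p.1 p.2 = r})
      (fun p => m (p.1.1 + p.1.2)) (fun p => m p.1.1) (by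
        rintro ⟨⟨s, d⟩, hs, hsr⟩ ⟨⟨s', d'⟩, hs', hsr'⟩
        obtain rfl : d = d' := by
          rw [← length_wordAt x s d, ← length_wordAt x s' d']
          exact congrArg _ (hsr.trans hsr'.symm)
        exact hret s s' d hs hs' (hsr.trans hsr'.symm))
    exact ⟨σ, fun s d hs hsr => hσ ⟨(s, d), hs, hsr⟩⟩
  choose σ hσ using hperm
  -- Freeness: the permutations chosen for the return words extend to an action of the whole free
  -- group.
  obtain ⟨φ, hφ⟩ := (hb t L).exists_hom (fun s => σ s.2.choose)
  have hφσ : ∀ r ∈ returnSet x t L, φ (toFreeGroup r) = σ r := by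
    intro r hr
    have hmem : toFreeGroup r ∈ toFreeGroup '' returnSet x t L := ⟨r, hr, rfl⟩
    rw [hφ ⟨_, hmem⟩]
    congr 1
    exact toFreeGroup_injective hmem.choose_spec.2
  obtain ⟨g, hg⟩ := exists_cocycle fun i => FreeGroup.of (x i)
  -- Transported back by the potential `g`, the lift is the same at all occurrences.
  have hconst : ∀ s s', Occ x t L s → Occ x t L s' → φ (g s) (m s) = φ (g s') (m s') := by
    intro s s' hs hs'
    refine eq_of_forall_isReturn (fun s => φ (g s) (m s)) ?_ hs hs'
    intro s d hs
    have h₁ : g (s + d) = g s * toFreeGroup (wordAt x s d) := by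
      rw [toFreeGroup_wordAt hg, mul_inv_cancel_left]
    have h₂ : φ (g (s + d)) (m (s + d)) = φ (g s) (m s) := by
      rw [h₁, map_mul, Equiv.Perm.mul_apply, hφσ _ ⟨s, d, hs, rfl⟩, hσ _ s d hs rfl]
    exact h₂.symm
  obtain ⟨w, hw⟩ := hloc
  -- By locality a longer window around `s` determines `m s`. Return words to that window therefore
  -- fix `φ u (m s)`; they generate the group, so every element fixes it, including `u⁻¹`.
  have hfix : ∀ s, Occ x t L s → ∀ u, φ u (m s) = m s := by
    intro s hs
    have hU : ∀ s', Occ x (s - w) (2 * w + L + 1) s' → Occ x t L (s' + w) ∧ m (s' + w) = m s := by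
      intro s' hs'
      have hx : ∀ k : ℤ, -w ≤ k → k ≤ L + w → x (s' + w + k) = x (s + k) := by
        intro k hk hk'
        have := hs' (k + w).toNat (by omega)
        rw [Int.toNat_of_nonneg (by omega)] at this
        convert this using 2 <;> ring
      refine ⟨fun k hk => (hx k (by omega) (by omega)).trans (hs k hk), ?_⟩
      rw [hm, hl]
      intro k hk
      refine hw _ _ fun n hn hn' => ?_
      rw [add_assoc, hx _ (by omega) (by omega), add_assoc]
    let u := toFreeGroup (wordAt x (s - w) w)
    have hu : ∀ s', Occ x (s - w) (2 * w + L + 1) s' → g (s' + w) = g s' * u := by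
      intro s' hs'
      have : wordAt x s' w = wordAt x (s - w) w :=
        wordAt_eq_iff.2 fun k hk => hs' k (by omega)
      simp only [u]
      rw [← this, toFreeGroup_wordAt hg, mul_inv_cancel_left]
    have hstab : ∀ r, φ r (φ u (m s)) = φ u (m s) := by
      intro r
      refine (hb (s - w) (2 * w + L + 1)).mem_of_subset
        (K := (MulAction.stabilizer (Equiv.Perm (Set.range l)) (φ u (m s))).comap φ) ?_ r
      rintro _ ⟨_, ⟨s', d, hs', rfl⟩, rfl⟩
      change φ _ (φ u (m s)) = φ u (m s)
      have h₁ := hu _ hs'.2.1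
      have h₂ := hu _ hs'.2.2.1
      obtain ⟨o₁, e₁⟩ := hU _ hs'.2.1
      obtain ⟨o₂, e₂⟩ := hU _ hs'.2.2.1
      have h₃ := hconst _ _ o₁ o₂
      rw [e₁, e₂, h₁, h₂, map_mul, map_mul, Equiv.Perm.mul_apply, Equiv.Perm.mul_apply] at h₃
      rw [toFreeGroup_wordAt hg, map_mul, Equiv.Perm.mul_apply, ← h₃, ← Equiv.Perm.mul_apply,
        ← map_mul, inv_mul_cancel, map_one, Equiv.Perm.one_apply]
    have hms : m s = φ u (m s) := by
      have := hstab u⁻¹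
      rwa [← Equiv.Perm.mul_apply, ← map_mul, inv_mul_cancel, map_one, Equiv.Perm.one_apply]
        at this
    intro r
    have := hstab r
    rwa [← hms] at this
  have hii : Occ x t L t := fun _ _ => rfl
  have := hconst t j hii hij
  rw [hfix t hii, hfix j hij, hm, hl] at this
  obtain ⟨k, hk, hk'⟩ := hne
  exact hk' (this k hk)

end Words

/-! ### Finite pigeonhole and counting lemmas. -/

theorem exists_forall_of_antitone {β : Type*} {S : Set β} (hS : S.Finite) {P : ℕ → β → Prop}
    (hP : ∀ m n s, m ≤ n → P n s → P m s) (h : ∀ m, ∃ s ∈ S, P m s) :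
    ∃ s ∈ S, ∀ m, P m s := by
  by_contra hcon
  push Not at hcon
  choose! k hk using hcon
  obtain ⟨s, hs, hPs⟩ := h (hS.toFinset.sup k)
  exact hk s hs (hP _ _ _ (Finset.le_sup (f := k) (hS.mem_toFinset.2 hs)) hPs)

theorem ncard_image_lt_of_eq {α β : Type*} {S : Set α} (hS : S.Finite) {h : α → β} {e e' : α}
    (he : e ∈ S) (he' : e' ∈ S) (hne : e ≠ e') (hee : h e = h e') :
    (h '' S).ncard + 1 ≤ S.ncard := by
  have hsub : h '' S ⊆ h '' (S \ {e'}) := by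
    rintro _ ⟨u, hu, rfl⟩
    by_cases hue : u = e'
    · exact ⟨e, ⟨he, hne⟩, by rw [hue, hee]⟩
    · exact ⟨u, ⟨hu, hue⟩, rfl⟩
  have h₁ := Set.ncard_le_ncard hsub (hS.sdiff.image _)
  have h₂ := Set.ncard_image_le (f := h) (hS.sdiff (t := {e'}))
  have h₃ := Set.ncard_sdiff_singleton_add_one he' hS
  omega

/-- Identifying `e` with `e'` already uses up the one element that may be lost, so no other pair is
identified. -/
theorem eq_or_of_ncard_image {α β : Type*} {S : Set α} (hS : S.Finite) {h : α → β} {e e' : α}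
    (he : e ∈ S) (he' : e' ∈ S) (hne : e ≠ e') (hee : h e = h e')
    (hcard : S.ncard ≤ (h '' S).ncard + 1) {u v : α} (hu : u ∈ S) (hv : v ∈ S)
    (huv : h u = h v) : u = v ∨ (u = e ∧ v = e') ∨ (u = e' ∧ v = e) := by
  have hsub : h '' S ⊆ h '' (S \ {e'}) := by
    rintro _ ⟨u, hu, rfl⟩
    by_cases hue : u = e'
    · exact ⟨e, ⟨he, hne⟩, by rw [hue, hee]⟩
    · exact ⟨u, ⟨hu, hue⟩, rfl⟩
  have h₁ := Set.ncard_le_ncard hsub (hS.sdiff.image _)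
  have h₃ := Set.ncard_sdiff_singleton_add_one he' hS
  have hinj : Set.InjOn h (S \ {e'}) := by
    refine Set.injOn_of_ncard_image_eq ?_ hS.sdiff
    exact le_antisymm (Set.ncard_image_le hS.sdiff) (by omega)
  by_cases h₄ : u = e' <;> by_cases h₅ : v = e'
  · exact Or.inl (h₄.trans h₅.symm)
  · refine Or.inr (Or.inr ⟨h₄, ?_⟩)
    exact hinj ⟨hv, h₅⟩ ⟨he, hne⟩ (by rw [← huv, h₄, hee])
  · refine Or.inr (Or.inl ⟨?_, h₅⟩)
    exact hinj ⟨hu, h₄⟩ ⟨he, hne⟩ (by rw [huv, h₅, hee])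
  · exact Or.inl (hinj ⟨hu, h₄⟩ ⟨hv, h₅⟩ huv)

/-! ### Folding a graph carrying `x` down to one vertex. -/

section Merging

variable {A V : Type*}

/-- The labelled edge traversed at time `i`. -/
def edgeAt (x : ℤ → A) (f : ℤ → V) (i : ℤ) : V × A × V :=
  (f i, x i, f (i + 1))

theorem edgeAt_eq_iff {x : ℤ → A} {f : ℤ → V} {i j : ℤ} :
    edgeAt x f i = edgeAt x f j ↔ f i = f j ∧ x i = x j ∧ f (i + 1) = f (j + 1) := by
  simp [edgeAt]

theorem coherent_edgeAt (x : ℤ → A) (f : ℤ → V) : Coherent f (edgeAt x f) :=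
  fun _ _ h => ⟨(edgeAt_eq_iff.1 h).1, (edgeAt_eq_iff.1 h).2.2⟩

theorem finite_range_edgeAt [Finite A] (x : ℤ → A) {f : ℤ → V} (hf : (Set.range f).Finite) :
    (Set.range (edgeAt x f)).Finite := by
  refine (hf.prod ((Set.toFinite (Set.univ : Set A)).prod hf)).subset ?_
  rintro _ ⟨i, rfl⟩
  exact ⟨⟨i, rfl⟩, Set.mem_univ _, ⟨i + 1, rfl⟩⟩

open Classical in
/-- Identify the vertex `q'` with `q`. -/
noncomputable def merge (q q' v : V) : V :=
  if v = q' then q else v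

/-- The action of `merge` on labelled edges. -/
noncomputable def mergeEdge (q q' : V) (u : V × A × V) : V × A × V :=
  (merge q q' u.1, u.2.1, merge q q' u.2.2)

theorem merge_self_right (q q' : V) : merge q q' q' = q := by simp [merge]

theorem merge_self_left (q q' : V) : merge q q' q = q := by simp [merge]

theorem merge_eq_iff {q q' u v : V} :
    merge q q' u = merge q q' v ↔ u = v ∨ (u = q ∧ v = q') ∨ (u = q' ∧ v = q) := by
  unfold merge
  split_ifs with h₁ h₂ h₂
  · simp [h₁, h₂]
  · subst h₁
    constructor
    · rintro rfl
      exact Or.inr (Or.inr ⟨rfl, rfl⟩)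
    · rintro (h | ⟨h, h'⟩ | ⟨-, h⟩)
      · exact absurd h.symm h₂
      · exact absurd h' h₂
      · exact h.symm
  · subst h₂
    constructor
    · rintro rfl
      exact Or.inr (Or.inl ⟨rfl, rfl⟩)
    · rintro (h | ⟨h, -⟩ | ⟨h, -⟩)
      · exact absurd h h₁
      · exact h
      · exact absurd h h₁
  · simp [h₁, h₂]

theorem edgeAt_merge (x : ℤ → A) (f : ℤ → V) (q q' : V) (i : ℤ) :
    edgeAt x (merge q q' ∘ f) i = mergeEdge q q' (edgeAt x f i) := rfl

theorem range_edgeAt_merge (x : ℤ → A) (f : ℤ → V) (q q' : V) :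
    Set.range (edgeAt x (merge q q' ∘ f)) = mergeEdge q q' '' Set.range (edgeAt x f) := by
  rw [← Set.range_comp]
  rfl

theorem ncard_range_merge {f : ℤ → V} (hf : (Set.range f).Finite) {q q' : V} (hne : q ≠ q')
    (hq : q ∈ Set.range f) (hq' : q' ∈ Set.range f) :
    (Set.range (merge q q' ∘ f)).ncard + 1 = (Set.range f).ncard := by
  have : Set.range (merge q q' ∘ f) = Set.range f \ {q'} := by
    ext v
    constructor
    · rintro ⟨i, rfl⟩
      by_cases h : f i = q'
      · simp only [Function.comp_apply, h, merge_self_right]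
        exact ⟨hq, hne⟩
      · have : merge q q' (f i) = f i := by simp [merge, h]
        simp only [Function.comp_apply, this]
        exact ⟨⟨i, rfl⟩, h⟩
    · rintro ⟨⟨i, rfl⟩, h⟩
      exact ⟨i, if_neg h⟩
  rw [this, Set.ncard_sdiff_singleton_add_one hq' hf]

theorem IsLocal.comp {W : Type*} {x : ℤ → A} {f : ℤ → V} (hf : IsLocal x f) (u : V → W) :
    IsLocal x (u ∘ f) := by
  obtain ⟨m, hm⟩ := hf
  exact ⟨m, fun i j h => congrArg u (hm i j h)⟩

/-- `e` and `e'` are edges with the same label and origin, with distinct targets `q` and `q'`,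
which can follow the same arbitrarily long paths; or the mirror image of this situation. -/
structure IsFoldable (x : ℤ → A) (f : ℤ → V) (e e' : V × A × V) (q q' : V) : Prop where
  ne : q ≠ q'
  edge_ne : e ≠ e'
  mem_left : e ∈ Set.range (edgeAt x f)
  mem_right : e' ∈ Set.range (edgeAt x f)
  vertex_left : q ∈ Set.range f
  vertex_right : q' ∈ Set.range f
  map_eq : mergeEdge q q' e = mergeEdge q q' e'
  long :
    (e.1 = e'.1 ∧ e.2.2 = q ∧ e'.2.2 = q' ∧ ∀ m : ℕ, ∃ a b, edgeAt x f a = e ∧ edgeAt x f b = e' ∧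
      ∀ k : ℕ, k < m → edgeAt x f (a - 1 - k) = edgeAt x f (b - 1 - k)) ∨
    (e.2.2 = e'.2.2 ∧ e.1 = q ∧ e'.1 = q' ∧ ∀ m : ℕ, ∃ a b, edgeAt x f a = e ∧ edgeAt x f b = e' ∧
      ∀ k : ℕ, k < m → edgeAt x f (a + 1 + k) = edgeAt x f (b + 1 + k))

/-- Iterates `exists_lifts_agree`: the word `r w` is again ambiguous and strictly longer than `w`.
-/
theorem exists_long_ambiguous {x : ℤ → A} {f : ℤ → V} (hfin : (Set.range f).Finite)
    (hloc : IsLocal x f) (hb : ∀ t L, IsBasis (toFreeGroup '' returnSet x t L))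
    (hne : ∃ i j, f i ≠ f j) (N : ℕ) :
    ∃ L ≥ N, ∃ i j, Occ x i L j ∧ ∃ k : ℕ, k ≤ L ∧ f (i + k) ≠ f (j + k) := by
  induction N with
  | zero =>
    obtain ⟨i, j, h⟩ := hne
    -- The empty word is ambiguous as soon as there are two vertices.
    exact ⟨0, le_rfl, i, j, fun k hk => absurd hk (by omega), 0, le_rfl, by simpa using h⟩
  | succ N ih =>
    obtain ⟨L, hL, i, j, hij, hk⟩ := ih
    obtain ⟨i, j, d, hd, hx, h⟩ := exists_lifts_agree hfin hloc hb L hij hk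
    refine ⟨d + L, by omega, i, j, fun k hk => (hx k hk).symm, ?_⟩
    rcases h with ⟨-, k, hk, h⟩ | ⟨⟨k, hk, h⟩, -⟩
    · refine ⟨d + k, by omega, ?_⟩
      push_cast
      rwa [← add_assoc, ← add_assoc]
    · exact ⟨k, by omega, h⟩

/-- The two lifts of `r w` agree along a copy of `w` of length at least `m` at one end; the first
disagreement met from that end gives the edges sought. -/
theorem exists_common_path {x : ℤ → A} {f : ℤ → V} (hfin : (Set.range f).Finite)
    (hloc : IsLocal x f) (hb : ∀ t L, IsBasis (toFreeGroup '' returnSet x t L))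
    (hne : ∃ i j, f i ≠ f j) (m : ℕ) :
    (∃ a b, f a = f b ∧ x a = x b ∧ f (a + 1) ≠ f (b + 1) ∧
      ∀ k : ℕ, k < m → edgeAt x f (a - 1 - k) = edgeAt x f (b - 1 - k)) ∨
    (∃ a b, f (a + 1) = f (b + 1) ∧ x a = x b ∧ f a ≠ f b ∧
      ∀ k : ℕ, k < m → edgeAt x f (a + 1 + k) = edgeAt x f (b + 1 + k)) := by
  classical
  obtain ⟨L, hL, i, j, hij, hk⟩ := exists_long_ambiguous hfin hloc hb hne m
  obtain ⟨i, j, d, hd, hx, ⟨hpre, k, hk, hdiff⟩ | ⟨⟨k, hk, hdiff⟩, hsuf⟩⟩ :=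
    exists_lifts_agree hfin hloc hb L hij hk
  · left
    have hex : ∃ n : ℕ, f (i + n) ≠ f (j + n) :=
      ⟨d + k, by push_cast; rwa [← add_assoc, ← add_assoc]⟩
    have hle : Nat.find hex ≤ d + k :=
      Nat.find_min' hex (by push_cast; rwa [← add_assoc, ← add_assoc])
    have hgt : L < Nat.find hex := by
      by_contra h
      exact Nat.find_spec hex (hpre _ (by omega))
    obtain ⟨n, hn⟩ : ∃ n, Nat.find hex = n + 1 := ⟨Nat.find hex - 1, by omega⟩
    have hag : ∀ l : ℕ, l ≤ n → f (i + l) = f (j + l) := fun l hl => by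
      by_contra h
      exact Nat.find_min hex (m := l) (by omega) h
    have hsp := Nat.find_spec hex
    rw [hn] at hsp
    push_cast at hsp
    refine ⟨i + n, j + n, hag n le_rfl, hx n (by omega), by rwa [add_assoc, add_assoc], ?_⟩
    intro k hk
    have e₁ : ∀ i : ℤ, i + n - 1 - k = i + ((n - 1 - k : ℕ) : ℤ) := fun i => by omega
    rw [e₁, e₁, edgeAt_eq_iff]
    refine ⟨hag _ (by omega), hx _ (by omega), ?_⟩
    have := hag (n - 1 - k + 1) (by omega)
    push_cast at this
    rwa [← add_assoc, ← add_assoc] at this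
  · right
    -- The disagreement is searched backwards from the start of the final copy of `w`.
    have hex : ∃ n : ℕ, f (i + d - n) ≠ f (j + d - n) := by
      by_contra hcon
      push Not at hcon
      rcases le_or_gt k d with hkd | hkd
      · have := hcon (d - k)
        rw [Nat.cast_sub hkd] at this
        exact hdiff (by convert this using 2 <;> ring)
      · have := hsuf (k - d) (by omega)
        rw [Nat.cast_sub hkd.le] at this
        exact hdiff (by convert this using 2 <;> ring)
    have hle : Nat.find hex ≤ d := by
      rcases le_or_gt k d with hkd | hkd
      · refine (Nat.find_min' hex (m := d - k) ?_).trans (by omega)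
        rw [Nat.cast_sub hkd]
        convert hdiff using 3 <;> ring
      · have := hsuf (k - d) (by omega)
        rw [Nat.cast_sub hkd.le] at this
        exact absurd (by convert this using 2 <;> ring) hdiff
    have hpos : 0 < Nat.find hex := by
      by_contra h
      have h0 : Nat.find hex = 0 := by omega
      have hsp := Nat.find_spec hex
      rw [h0] at hsp
      exact hsp (by simpa using hsuf 0 (by omega))
    obtain ⟨n, hn⟩ : ∃ n, Nat.find hex = n + 1 := ⟨Nat.find hex - 1, by omega⟩
    have hag : ∀ l : ℕ, d - n ≤ l → l ≤ d + L → f (i + l) = f (j + l) := fun l hl hl' => by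
      rcases le_or_gt d l with h | h
      · have := hsuf (l - d) (by omega)
        rw [Nat.cast_sub h] at this
        convert this using 2 <;> ring
      · by_contra h'
        refine Nat.find_min hex (m := d - l) (by omega) ?_
        rw [Nat.cast_sub h.le]
        convert h' using 3 <;> ring
    have hsp := Nat.find_spec hex
    rw [hn] at hsp
    have e₀ : ∀ i : ℤ, i + d - ((n + 1 : ℕ) : ℤ) = i + ((d - (n + 1) : ℕ) : ℤ) :=
      fun i => by omega
    have e₁ : ∀ i : ℤ, i + ((d - (n + 1) : ℕ) : ℤ) + 1 = i + ((d - n : ℕ) : ℤ) :=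
      fun i => by omega
    rw [e₀, e₀] at hsp
    refine ⟨i + ((d - (n + 1) : ℕ) : ℤ), j + ((d - (n + 1) : ℕ) : ℤ), ?_, hx _ (by omega), hsp, ?_⟩
    · rw [e₁, e₁]
      exact hag _ le_rfl (by omega)
    · intro k hk
      rw [e₁, e₁, edgeAt_eq_iff]
      have h₁ := hag (d - n + k) (by omega) (by omega)
      have h₂ := hx (d - n + k) (by omega)
      have h₃ := hag (d - n + k + 1) (by omega) (by omega)
      rw [Nat.cast_add] at h₁ h₂
      rw [Nat.cast_add, Nat.cast_add, Nat.cast_one] at h₃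
      simp only [← add_assoc] at h₁ h₂ h₃
      exact ⟨h₁, h₂, h₃⟩

variable [Finite A]

/-- There are finitely many pairs of edges and two directions, so one pair in one direction serves
for every length `m`. -/
theorem exists_isFoldable {x : ℤ → A} {f : ℤ → V} (hfin : (Set.range f).Finite)
    (hloc : IsLocal x f) (hb : ∀ t L, IsBasis (toFreeGroup '' returnSet x t L))
    (hne : ∃ i j, f i ≠ f j) : ∃ e e' q q', IsFoldable x f e e' q q' := by
  have hE := finite_range_edgeAt x hfin
  let P : ℕ → (V × A × V) × (V × A × V) → Prop := fun m u => ∃ a b, edgeAt x f a = u.1 ∧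
    edgeAt x f b = u.2 ∧ f a = f b ∧ x a = x b ∧ f (a + 1) ≠ f (b + 1) ∧
    ∀ k : ℕ, k < m → edgeAt x f (a - 1 - k) = edgeAt x f (b - 1 - k)
  let Q : ℕ → (V × A × V) × (V × A × V) → Prop := fun m u => ∃ a b, edgeAt x f a = u.1 ∧
    edgeAt x f b = u.2 ∧ f (a + 1) = f (b + 1) ∧ x a = x b ∧ f a ≠ f b ∧
    ∀ k : ℕ, k < m → edgeAt x f (a + 1 + k) = edgeAt x f (b + 1 + k)
  have hP : ∀ m n s, m ≤ n → P n s → P m s := by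
    rintro m n s hmn ⟨a, b, h₁, h₂, h₃, h₄, h₅, h₆⟩
    exact ⟨a, b, h₁, h₂, h₃, h₄, h₅, fun k hk => h₆ k (by omega)⟩
  have hQ : ∀ m n s, m ≤ n → Q n s → Q m s := by
    rintro m n s hmn ⟨a, b, h₁, h₂, h₃, h₄, h₅, h₆⟩
    exact ⟨a, b, h₁, h₂, h₃, h₄, h₅, fun k hk => h₆ k (by omega)⟩
  have hPQ : ∀ m, ∃ s ∈ Set.range (edgeAt x f) ×ˢ Set.range (edgeAt x f), P m s ∨ Q m s := by
    intro m
    rcases exists_common_path hfin hloc hb hne m with ⟨a, b, h⟩ | ⟨a, b, h⟩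
    · exact ⟨(edgeAt x f a, edgeAt x f b), ⟨⟨a, rfl⟩, ⟨b, rfl⟩⟩, Or.inl ⟨a, b, rfl, rfl, h⟩⟩
    · exact ⟨(edgeAt x f a, edgeAt x f b), ⟨⟨a, rfl⟩, ⟨b, rfl⟩⟩, Or.inr ⟨a, b, rfl, rfl, h⟩⟩
  obtain ⟨⟨e, e'⟩, ⟨he, he'⟩, hee⟩ := exists_forall_of_antitone (hE.prod hE)
    (fun m n s hmn h => h.imp (hP m n s hmn) (hQ m n s hmn)) hPQ
  have hcases : (∀ m, P m (e, e')) ∨ ∀ m, Q m (e, e') := by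
    by_contra hcon
    push Not at hcon
    obtain ⟨⟨m, hm⟩, ⟨n, hn⟩⟩ := hcon
    rcases hee (max m n) with h | h
    · exact hm (hP _ _ _ (le_max_left _ _) h)
    · exact hn (hQ _ _ _ (le_max_right _ _) h)
  rcases hcases with h | h
  · obtain ⟨a, b, rfl, rfl, h₃, h₄, h₅, -⟩ := h 0
    refine ⟨_, _, f (a + 1), f (b + 1), h₅, ?_, he, he', ⟨_, rfl⟩, ⟨_, rfl⟩, ?_, Or.inl
      ⟨h₃, rfl, rfl, fun m => ?_⟩⟩
    · intro hab
      exact h₅ (edgeAt_eq_iff.1 hab).2.2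
    · simp [mergeEdge, edgeAt, h₃, h₄, merge_self_left, merge_self_right]
    · obtain ⟨c, d, h₁, h₂, -, -, -, h₆⟩ := h m
      exact ⟨c, d, h₁, h₂, h₆⟩
  · obtain ⟨a, b, rfl, rfl, h₃, h₄, h₅, -⟩ := h 0
    refine ⟨_, _, f a, f b, h₅, ?_, he, he', ⟨_, rfl⟩, ⟨_, rfl⟩, ?_, Or.inr
      ⟨h₃, rfl, rfl, fun m => ?_⟩⟩
    · intro hab
      exact h₅ (edgeAt_eq_iff.1 hab).1
    · simp [mergeEdge, edgeAt, h₃, h₄, merge_self_left, merge_self_right]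
    · obtain ⟨c, d, h₁, h₂, -, -, -, h₆⟩ := h m
      exact ⟨c, d, h₁, h₂, h₆⟩

/-- A connected graph carrying the path `f` has rank at least the number of letters. -/
theorem ncard_range_add_card_le {x : ℤ → A} (hx : Function.Surjective x)
    (hb : ∀ t L, IsBasis (toFreeGroup '' returnSet x t L)) {f : ℤ → V}
    (hfin : (Set.range f).Finite) (hloc : IsLocal x f) :
    (Set.range f).ncard + Nat.card A ≤ (Set.range (edgeAt x f)).ncard + 1 := by
  induction hN : (Set.range f).ncard generalizing f with
  | zero =>
    rw [Set.ncard_eq_zero hfin] at hN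
    exact absurd hN (Set.range_nonempty f).ne_empty
  | succ N ih =>
    have hE := finite_range_edgeAt x hfin
    by_cases hne : ∃ i j, f i ≠ f j
    · obtain ⟨e, e', q, q', H⟩ := exists_isFoldable hfin hloc hb hne
      have h₁ := ncard_range_merge hfin H.ne H.vertex_left H.vertex_right
      have h₂ := ih (f := merge q q' ∘ f) ((hfin.image (merge q q')).subset
        (by rw [Set.range_comp])) (hloc.comp _) (by omega)
      -- The fold loses exactly one vertex and at least one edge, so the bound for the folded graph
      -- implies the bound here.
      have h₃ := ncard_image_lt_of_eq hE H.mem_left H.mem_right H.edge_ne H.map_eq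
      rw [range_edgeAt_merge] at h₂
      omega
    · push Not at hne
      have h₁ : Set.range f = {f 0} := by
        ext v
        constructor
        · rintro ⟨i, rfl⟩
          exact hne i 0
        · rintro rfl
          exact ⟨0, rfl⟩
      rw [h₁, Set.ncard_singleton] at hN
      -- With a single vertex, every letter still labels some edge.
      have h₂ : (fun u : V × A × V => u.2.1) '' Set.range (edgeAt x f) = Set.univ := by
        rw [← Set.range_comp]
        exact hx.range_eq
      have h₃ := Set.ncard_image_le (f := fun u : V × A × V => u.2.1) hE
      rw [h₂, Set.ncard_univ] at h₃
      omega

/-- The edge count forces the merge to identify only `e` and `e'`, so it is an `IsFold`, directly or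
after time reversal. -/
theorem IsFoldable.isTreeRel {x : ℤ → A} {f : ℤ → V} {e e' : V × A × V} {q q' : V}
    (H : IsFoldable x f e e' q q') (hfin : (Set.range f).Finite)
    (hcard : (Set.range (edgeAt x f)).ncard ≤ (Set.range (edgeAt x (merge q q' ∘ f))).ncard + 1)
    {g : ℕ} (ht : ∀ n < g, ∀ i, IsTreeRel (extRel f (edgeAt x f) n i)) :
    ∀ n < g, ∀ i, IsTreeRel (extRel (merge q q' ∘ f) (edgeAt x (merge q q' ∘ f)) n i) := by
  have hE := finite_range_edgeAt x hfin
  rw [range_edgeAt_merge] at hcard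
  have hedge : ∀ i j, mergeEdge q q' (edgeAt x f i) = mergeEdge q q' (edgeAt x f j) →
      edgeAt x f i = edgeAt x f j ∨ (edgeAt x f i = e ∧ edgeAt x f j = e') ∨
        (edgeAt x f i = e' ∧ edgeAt x f j = e) := fun i j hij =>
    eq_or_of_ncard_image hE H.mem_left H.mem_right H.edge_ne H.map_eq hcard ⟨i, rfl⟩ ⟨j, rfl⟩ hij
  rcases H.long with ⟨h₁, h₂, h₃, hlong⟩ | ⟨h₁, h₂, h₃, hlong⟩
  · have F : IsFold f (edgeAt x f) (merge q q' ∘ f) (edgeAt x (merge q q' ∘ f)) (mergeEdge q q')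
        e e' e.1 q q' :=
      { coherent := coherent_edgeAt x f
        map_edge := edgeAt_merge x f q q'
        edge_eq := hedge
        map_eq := H.map_eq
        vertex_eq := fun i j => merge_eq_iff
        ne := H.ne
        left := fun i hi => ⟨by rw [← hi]; rfl, by rw [← h₂, ← hi]; rfl⟩
        right := fun i hi => ⟨by rw [h₁, ← hi]; rfl, by rw [← h₃, ← hi]; rfl⟩
        long := hlong }
    exact F.isTreeRel ht
  · have hrev : Coherent (fun k => f (-k)) (fun k => edgeAt x f (-1 - k)) := by
      intro i j hij
      obtain ⟨k₁, k₂⟩ := coherent_edgeAt x f _ _ hij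
      have e₁ : ∀ i : ℤ, -1 - i + 1 = -i := fun i => by ring
      have e₂ : ∀ i : ℤ, -(i + 1) = -1 - i := fun i => by ring
      rw [e₁, e₁] at k₂
      exact ⟨k₂, by simpa only [e₂] using k₁⟩
    have F : IsFold (fun k => f (-k)) (fun k => edgeAt x f (-1 - k))
        (fun k => (merge q q' ∘ f) (-k)) (fun k => edgeAt x (merge q q' ∘ f) (-1 - k))
        (mergeEdge q q') e e' e.2.2 q q' :=
      { coherent := hrev
        map_edge := fun i => edgeAt_merge x f q q' _
        edge_eq := fun i j => hedge _ _
        map_eq := H.map_eq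
        vertex_eq := fun i j => merge_eq_iff
        ne := H.ne
        left := fun i hi => by
          have e₁ : -1 - i + 1 = -i := by ring
          have e₂ : -(i + 1) = -1 - i := by ring
          refine ⟨?_, ?_⟩
          · rw [← hi, edgeAt, e₁]
          · rw [← h₂, ← hi, e₂]; rfl
        right := fun i hi => by
          have e₁ : -1 - i + 1 = -i := by ring
          have e₂ : -(i + 1) = -1 - i := by ring
          refine ⟨?_, ?_⟩
          · rw [h₁, ← hi, edgeAt, e₁]
          · rw [← h₃, ← hi, e₂]; rfl
        long := fun m => by
          obtain ⟨a, b, ha, hb, hab⟩ := hlong m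
          have e₁ : ∀ a : ℤ, -1 - (-1 - a) = a := fun a => by ring
          refine ⟨-1 - a, -1 - b, by rw [e₁, ha], by rw [e₁, hb], fun k hk => ?_⟩
          have e₂ : ∀ a : ℤ, -1 - (-1 - a - 1 - k) = a + 1 + k := fun a => by ring
          rw [e₂, e₂]
          exact hab k hk }
    have ht' : ∀ n < g, ∀ i,
        IsTreeRel (extRel (fun k => f (-k)) (fun k => edgeAt x f (-1 - k)) n i) := by
      intro n hn i
      rw [extRel_reverse _ _ (coherent_edgeAt x f)]
      exact isTreeRel_swap (ht n hn _)
    intro n hn i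
    have := isTreeRel_swap (F.isTreeRel ht' n hn (-i - n))
    rw [extRel_reverse _ _ (coherent_edgeAt x _), Set.image_image] at this
    simpa using this

/-- If the extension graphs of the short paths of some graph of minimal rank carrying `x` are
trees, then the extension graphs of the short words of `x` are trees. -/
theorem isTreeRel_of_graph {x : ℤ → A} (hx : Function.Surjective x)
    (hb : ∀ t L, IsBasis (toFreeGroup '' returnSet x t L)) {g : ℕ} {f : ℤ → V}
    (hfin : (Set.range f).Finite) (hloc : IsLocal x f)
    (hcard : (Set.range (edgeAt x f)).ncard + 1 ≤ (Set.range f).ncard + Nat.card A)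
    (ht : ∀ n < g, ∀ i, IsTreeRel (extRel f (edgeAt x f) n i)) :
    ∀ n < g, ∀ i, IsTreeRel (extRel (fun _ => ()) x n i) := by
  induction hN : (Set.range f).ncard generalizing f with
  | zero =>
    rw [Set.ncard_eq_zero hfin] at hN
    exact absurd hN (Set.range_nonempty f).ne_empty
  | succ N ih =>
    by_cases hne : ∃ i j, f i ≠ f j
    · obtain ⟨e, e', q, q', H⟩ := exists_isFoldable hfin hloc hb hne
      have h₁ := ncard_range_merge hfin H.ne H.vertex_left H.vertex_right
      have hfin' : (Set.range (merge q q' ∘ f)).Finite :=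
        (hfin.image (merge q q')).subset (by rw [Set.range_comp])
      -- The rank is already minimal, so the rank bound for the folded graph allows only one edge to
      -- be lost.
      have h₂ := ncard_range_add_card_le hx hb hfin' (hloc.comp (merge q q'))
      have h₃ := ncard_image_lt_of_eq (finite_range_edgeAt x hfin) H.mem_left H.mem_right
        H.edge_ne H.map_eq
      rw [← range_edgeAt_merge] at h₃
      exact ih hfin' (hloc.comp _) (by omega) (H.isTreeRel hfin (by omega) ht) (by omega)
    · push Not at hne
      intro n hn i
      have hw : ∀ j, SameWindow (fun _ => ()) x n i j ↔ SameWindow f (edgeAt x f) n i j := by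
        intro j
        refine ⟨fun h => ⟨hne _ _, fun k hk => ?_⟩, fun h => ⟨rfl, fun k hk => ?_⟩⟩
        · exact edgeAt_eq_iff.2 ⟨hne _ _, h.2 k hk, hne _ _⟩
        · exact (edgeAt_eq_iff.1 (h.2 k hk)).2.1
      let l : V × A × V → A := fun u => u.2.1
      have heq : extRel (fun _ => ()) x n i = Prod.map l l '' extRel f (edgeAt x f) n i := by
        ext u
        constructor
        · rintro ⟨j, hj, rfl⟩
          exact ⟨_, ⟨j, (hw j).1 hj, rfl⟩, rfl⟩
        · rintro ⟨_, ⟨j, hj, rfl⟩, rfl⟩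
          exact ⟨j, (hw j).2 hj, rfl⟩
      rw [heq]
      refine (ht n hn i).image ?_ ?_
      · rintro _ ⟨_, ⟨j, -, rfl⟩, rfl⟩ _ ⟨_, ⟨k, -, rfl⟩, rfl⟩ h
        exact edgeAt_eq_iff.2 ⟨hne _ _, h, hne _ _⟩
      · rintro _ ⟨_, ⟨j, -, rfl⟩, rfl⟩ _ ⟨_, ⟨k, -, rfl⟩, rfl⟩ h
        exact edgeAt_eq_iff.2 ⟨hne _ _, h, hne _ _⟩

end Merging

/-! ### The initial graph: a segment closed up by return words. -/

section StartGraph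

variable {A : Type*}

open Classical in
/-- The vertex visited at time `i` in the graph made of a segment of length `g`, followed by one
loop for each return word: it is `k` if the reference word occurs at `i - k` for some `k ≤ g`, and
the word read until the next occurrence otherwise. -/
noncomputable def segmentGraph (x : ℤ → A) (t : ℤ) (L g : ℕ) (i : ℤ) : ℕ ⊕ List A :=
  if h : ∃ k : ℕ, k ≤ g ∧ Occ x t L (i - k) then Sum.inl (Nat.find h)
  else if h : ∃ k : ℕ, Occ x t L (i + k) then Sum.inr (wordAt x i (Nat.find h))
  -- Never reached when the reference word is recurrent.
  else Sum.inr []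

theorem segmentGraph_eq_inr {x : ℤ → A} {t : ℤ} {L g : ℕ} {i : ℤ} {d : ℕ}
    (h₁ : ∀ k : ℕ, k ≤ g → ¬ Occ x t L (i - k)) (h₂ : Occ x t L (i + d))
    (h₃ : ∀ k : ℕ, k < d → ¬ Occ x t L (i + k)) :
    segmentGraph x t L g i = Sum.inr (wordAt x i d) := by
  classical
  have h : ∃ k : ℕ, Occ x t L (i + k) := ⟨d, h₂⟩
  rw [segmentGraph, dif_neg (by push Not; exact h₁), dif_pos h]
  have : Nat.find h = d := (Nat.find_eq_iff h).2 ⟨h₂, h₃⟩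
  rw [this]

theorem occ_self (x : ℤ → A) (t : ℤ) (L : ℕ) : Occ x t L t := fun _ _ => rfl

/-- Distinct occurrences of the reference word are more than `g` apart. -/
def HasGap (x : ℤ → A) (t : ℤ) (L g : ℕ) : Prop :=
  ∀ s : ℤ, ∀ d : ℕ, 0 < d → Occ x t L s → Occ x t L (s + d) → g < d

/-- The reference word occurs in every window of length `N`. -/
def IsRecurrent (x : ℤ → A) (t : ℤ) (L N : ℕ) : Prop :=
  ∀ s : ℤ, ∃ k : ℕ, k ≤ N ∧ Occ x t L (s + k)

variable {x : ℤ → A} {t : ℤ} {L g N : ℕ}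

theorem segmentGraph_eq_inl (hgap : HasGap x t L g) {i : ℤ} {k : ℕ} (hk : k ≤ g)
    (h : Occ x t L (i - k)) : segmentGraph x t L g i = Sum.inl k := by
  classical
  have hex : ∃ k : ℕ, k ≤ g ∧ Occ x t L (i - k) := ⟨k, hk, h⟩
  rw [segmentGraph, dif_pos hex]
  have hle : Nat.find hex ≤ k := Nat.find_min' hex ⟨hk, h⟩
  obtain ⟨h₁, h₂⟩ := Nat.find_spec hex
  congr 1
  by_contra hne
  have := hgap (i - k) (k - Nat.find hex) (by omega) h (by
    rw [Nat.cast_sub hle]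
    convert h₂ using 1
    ring)
  omega

theorem occ_of_segmentGraph_eq_inl {i : ℤ} {k : ℕ} (h : segmentGraph x t L g i = Sum.inl k) :
    k ≤ g ∧ Occ x t L (i - k) := by
  classical
  unfold segmentGraph at h
  split_ifs at h with h₁ h₂
  rw [← Sum.inl.inj h]
  exact Nat.find_spec h₁

theorem segmentGraph_cases (hrec : IsRecurrent x t L N) (i : ℤ) :
    (∃ k : ℕ, k ≤ g ∧ Occ x t L (i - k)) ∨
    ∃ d : ℕ, d ≤ N ∧ 0 < d ∧ (∀ k : ℕ, k ≤ g → ¬ Occ x t L (i - k)) ∧ Occ x t L (i + d) ∧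
      ∀ k : ℕ, k < d → ¬ Occ x t L (i + k) := by
  classical
  by_cases h : ∃ k : ℕ, k ≤ g ∧ Occ x t L (i - k)
  · exact Or.inl h
  · right
    push Not at h
    obtain ⟨k, hk, hocc⟩ := hrec i
    have hex : ∃ k : ℕ, Occ x t L (i + k) := ⟨k, hocc⟩
    refine ⟨Nat.find hex, (Nat.find_min' hex hocc).trans hk, Nat.pos_of_ne_zero fun h₀ => ?_, h,
      Nat.find_spec hex, fun k hk => Nat.find_min hex hk⟩
    have := Nat.find_spec hex
    rw [h₀] at this
    exact h 0 (by omega) (by simpa using this)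

theorem finite_range_segmentGraph [Finite A] (hgap : HasGap x t L g) (hrec : IsRecurrent x t L N) :
    (Set.range (segmentGraph x t L g)).Finite := by
  refine (((Set.finite_le_nat g).image Sum.inl).union
    ((List.finite_length_le A N).image Sum.inr)).subset ?_
  rintro _ ⟨i, rfl⟩
  rcases segmentGraph_cases (g := g) hrec i with ⟨k, hk, h⟩ | ⟨d, hd, -, h₁, h₂, h₃⟩
  · exact Or.inl ⟨k, hk, (segmentGraph_eq_inl hgap hk h).symm⟩
  · exact Or.inr ⟨_, by simpa [length_wordAt] using hd, (segmentGraph_eq_inr h₁ h₂ h₃).symm⟩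

theorem isLocal_segmentGraph (hgap : HasGap x t L g) (hrec : IsRecurrent x t L N) :
    IsLocal x (segmentGraph x t L g) := by
  -- Occurrences are sought from `g` steps back to `N` steps ahead, and each is a condition on `L`
  -- letters.
  refine ⟨g + N + L, fun i j hij => ?_⟩
  have hocc : ∀ k : ℤ, -g ≤ k → k ≤ N → (Occ x t L (j + k) ↔ Occ x t L (i + k)) := by
    intro k hk hk'
    have : ∀ n : ℕ, n < L → x (j + k + n) = x (i + k + n) := by
      intro n hn
      rw [add_assoc, add_assoc]
      exact hij _ (by push_cast; omega) (by push_cast; omega)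
    exact ⟨fun h n hn => by rw [← this n hn, h n hn], fun h n hn => by rw [this n hn, h n hn]⟩
  rcases segmentGraph_cases (g := g) hrec i with ⟨k, hk, h⟩ | ⟨d, hd, -, h₁, h₂, h₃⟩
  · rw [segmentGraph_eq_inl hgap hk h, segmentGraph_eq_inl hgap hk]
    rw [sub_eq_add_neg] at h ⊢
    exact (hocc _ (by omega) (by omega)).2 h
  · rw [segmentGraph_eq_inr h₁ h₂ h₃, segmentGraph_eq_inr (d := d)]
    · congr 1
      refine wordAt_eq_iff.2 fun k hk => hij _ ?_ ?_ <;> push_cast <;> omega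
    · intro k hk
      have := h₁ k hk
      rw [sub_eq_add_neg] at this ⊢
      rwa [hocc _ (by omega) (by omega)]
    · rwa [hocc _ (by omega) (by omega)]
    · intro k hk
      rw [hocc _ (by omega) (by omega)]
      exact h₃ k hk

/-- On the segment, the next edge is determined. -/
theorem edgeAt_segmentGraph_inl (hL : g ≤ L) (hgap : HasGap x t L g) {i : ℤ} {k : ℕ} (hk : k < g)
    (h : segmentGraph x t L g i = Sum.inl k) :
    edgeAt x (segmentGraph x t L g) i = (Sum.inl k, x (t + k), Sum.inl (k + 1)) := by
  obtain ⟨-, hocc⟩ := occ_of_segmentGraph_eq_inl h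
  have h₁ : x i = x (t + k) := by
    have := hocc k (by omega)
    rwa [sub_add_cancel] at this
  have h₂ : segmentGraph x t L g (i + 1) = Sum.inl (k + 1) := by
    refine segmentGraph_eq_inl hgap (by omega) ?_
    push_cast
    rwa [add_sub_add_right_eq_sub]
  rw [edgeAt, h, h₁, h₂]

/-- A vertex off the segment records all that remains to be read before the next occurrence, hence
the next letter and the next vertex. -/
theorem edgeAt_segmentGraph_inr (hgap : HasGap x t L g) (hrec : IsRecurrent x t L N) {i j : ℤ}
    (hi : ∀ k, segmentGraph x t L g i ≠ Sum.inl k)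
    (hij : segmentGraph x t L g i = segmentGraph x t L g j) :
    edgeAt x (segmentGraph x t L g) i = edgeAt x (segmentGraph x t L g) j := by
  rcases segmentGraph_cases (g := g) hrec i with ⟨k, hk, h⟩ | ⟨d, -, hd, h₁, h₂, h₃⟩
  · exact absurd (segmentGraph_eq_inl hgap hk h) (hi k)
  rcases segmentGraph_cases (g := g) hrec j with ⟨k, hk, h⟩ | ⟨d', -, hd', h₁', h₂', h₃'⟩
  · exact absurd (hij.trans (segmentGraph_eq_inl hgap hk h)) (hi k)
  have hw := hij
  rw [segmentGraph_eq_inr h₁ h₂ h₃, segmentGraph_eq_inr h₁' h₂' h₃', Sum.inr.injEq] at hw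
  obtain rfl : d = d' := by
    rw [← length_wordAt x i d, ← length_wordAt x j d', hw]
  rw [wordAt_eq_iff] at hw
  rw [edgeAt_eq_iff]
  refine ⟨hij, by simpa using hw 0 hd, ?_⟩
  obtain ⟨d, rfl⟩ : ∃ n, d = n + 1 := ⟨d - 1, by omega⟩
  have hstep : ∀ i, (∀ k : ℕ, k ≤ g → ¬ Occ x t L (i - k)) → Occ x t L (i + (d + 1 : ℕ)) →
      (∀ k : ℕ, k < d + 1 → ¬ Occ x t L (i + k)) →
      segmentGraph x t L g (i + 1) = if d = 0 then Sum.inl 0 else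
        Sum.inr (wordAt x (i + 1) d) := by
    intro i h₁ h₂ h₃
    push_cast at h₂
    rw [add_comm (d : ℤ), ← add_assoc] at h₂
    split_ifs with h₀
    · subst h₀
      exact segmentGraph_eq_inl hgap (by omega) (by simpa using h₂)
    · refine segmentGraph_eq_inr ?_ h₂ ?_
      · intro k hk
        rcases k with _ | k
        · have := h₃ 1 (by omega)
          simpa using this
        · push_cast
          rw [add_sub_add_right_eq_sub]
          exact h₁ k (by omega)
      · intro k hk
        have := h₃ (k + 1) (by omega)
        push_cast at this
        rwa [add_comm (k : ℤ), ← add_assoc] at this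
  rw [hstep i h₁ h₂ h₃, hstep j h₁' h₂' h₃']
  have : wordAt x (i + 1) d = wordAt x (j + 1) d := by
    refine wordAt_eq_iff.2 fun k hk => ?_
    have := hw (k + 1) (by omega)
    push_cast at this
    rwa [add_comm (k : ℤ), ← add_assoc, ← add_assoc] at this
  rw [this]

/-- The edge following the segment is determined by the return word. -/
theorem edgeAt_segmentGraph_end (hgap : HasGap x t L g) {s s' : ℤ} {d : ℕ}
    (hs : IsReturn x t L s d) (hs' : IsReturn x t L s' d) (hw : wordAt x s d = wordAt x s' d) :
    edgeAt x (segmentGraph x t L g) (s + g) = edgeAt x (segmentGraph x t L g) (s' + g) := by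
  have hgd : g < d := hgap s d hs.1 hs.2.1 hs.2.2.1
  rw [wordAt_eq_iff] at hw
  have hstep : ∀ s, IsReturn x t L s d → segmentGraph x t L g (s + g) = Sum.inl g ∧
      segmentGraph x t L g (s + g + 1) = if d = g + 1 then Sum.inl 0 else
        Sum.inr (wordAt x (s + g + 1) (d - (g + 1))) := by
    intro s hs
    refine ⟨segmentGraph_eq_inl hgap le_rfl (by simpa using hs.2.1), ?_⟩
    have e : s + g + 1 + ((d - (g + 1) : ℕ) : ℤ) = s + d := by omega
    split_ifs with h₀
    · refine segmentGraph_eq_inl hgap (by omega) ?_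
      have := hs.2.2.1
      rw [h₀] at this
      push_cast at this
      simpa [add_assoc] using this
    · refine segmentGraph_eq_inr ?_ (e ▸ hs.2.2.1) ?_
      · intro k hk
        have := hs.2.2.2 (g + 1 - k) (by omega) (by omega)
        rw [Nat.cast_sub (by omega)] at this
        convert this using 2
        push_cast
        ring
      · intro k hk
        have := hs.2.2.2 (g + 1 + k) (by omega) (by omega)
        push_cast at this
        rwa [← add_assoc, ← add_assoc] at this
  obtain ⟨h₁, h₂⟩ := hstep s hs
  obtain ⟨h₁', h₂'⟩ := hstep s' hs'
  have : wordAt x (s + g + 1) (d - (g + 1)) = wordAt x (s' + g + 1) (d - (g + 1)) := by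
    refine wordAt_eq_iff.2 fun k hk => ?_
    have := hw (g + 1 + k) (by omega)
    push_cast at this
    simpa only [← add_assoc] using this
  rw [edgeAt_eq_iff, h₁, h₁', h₂, h₂', this]
  exact ⟨rfl, hw g hgd, rfl⟩

/-- Exactly one edge leaves each vertex other than the end of the segment, and at most one per
return word leaves that end. Return words with a common suffix may share vertices, which does not
affect this count. -/
theorem ncard_range_edgeAt_segmentGraph [Finite A] (hL : g ≤ L) (hgap : HasGap x t L g)
    (hrec : IsRecurrent x t L N) (hret : (returnSet x t L).Finite) :
    (Set.range (edgeAt x (segmentGraph x t L g))).ncard + 1 ≤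
      (Set.range (segmentGraph x t L g)).ncard + (returnSet x t L).ncard := by
  classical
  set f := segmentGraph x t L g with hf
  have hfin := finite_range_segmentGraph hgap hrec
  rw [← hf] at hfin
  have hE := finite_range_edgeAt x hfin
  let S₁ : Set _ := {u | u ∈ Set.range (edgeAt x f) ∧ u.1 ≠ Sum.inl g}
  let S₂ : Set _ := {u | u ∈ Set.range (edgeAt x f) ∧ u.1 = Sum.inl g}
  have hS : Set.range (edgeAt x f) = S₁ ∪ S₂ := by
    ext u
    simp only [S₁, S₂, Set.mem_union, Set.mem_ofPred_eq, ← and_or_left]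
    tauto
  have hg : (Sum.inl g : ℕ ⊕ List A) ∈ Set.range f :=
    ⟨t + g, segmentGraph_eq_inl hgap le_rfl (by simpa using occ_self x t L)⟩
  have h₁ : S₁.ncard ≤ (Set.range f \ {Sum.inl g}).ncard := by
    refine Set.ncard_le_ncard_of_injOn Prod.fst ?_ ?_ hfin.sdiff
    · rintro _ ⟨⟨i, rfl⟩, hi⟩
      exact ⟨⟨i, rfl⟩, hi⟩
    · rintro _ ⟨⟨i, rfl⟩, hi⟩ _ ⟨⟨j, rfl⟩, hj⟩ hij
      change f i = f j at hij
      change f i ≠ Sum.inl g at hi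
      by_cases hk : ∃ k, f i = Sum.inl k
      · obtain ⟨k, hk⟩ := hk
        have hkg : k < g := lt_of_le_of_ne (occ_of_segmentGraph_eq_inl hk).1
          fun h => hi (by rw [hk, h])
        rw [edgeAt_segmentGraph_inl hL hgap hkg hk,
          edgeAt_segmentGraph_inl hL hgap hkg (hij.symm.trans hk)]
      · push Not at hk
        exact edgeAt_segmentGraph_inr hgap hrec hk hij
  have h₂ : S₂.ncard ≤ (returnSet x t L).ncard := by
    have hex : ∀ r ∈ returnSet x t L, ∃ s d, IsReturn x t L s d ∧ r = wordAt x s d := fun _ h => h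
    choose! s d hs using hex
    have hsub : S₂ ⊆ (fun r => edgeAt x f (s r + g)) '' returnSet x t L := by
      rintro _ ⟨⟨i, rfl⟩, hi⟩
      change f i = Sum.inl g at hi
      obtain ⟨-, hocc⟩ := occ_of_segmentGraph_eq_inl hi
      obtain ⟨n, -, hn⟩ := hrec (i - g + 1)
      have hex : ∃ k : ℕ, 0 < k ∧ Occ x t L (i - g + k) :=
        ⟨n + 1, by omega, by push_cast; rwa [add_comm (n : ℤ), ← add_assoc]⟩
      have hr : IsReturn x t L (i - g) (Nat.find hex) :=
        ⟨(Nat.find_spec hex).1, hocc, (Nat.find_spec hex).2,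
          fun k hk hk' ho => Nat.find_min hex hk' ⟨hk, ho⟩⟩
      have hmem : wordAt x (i - g) (Nat.find hex) ∈ returnSet x t L := ⟨_, _, hr, rfl⟩
      refine ⟨_, hmem, ?_⟩
      obtain ⟨hs₁, hs₂⟩ := hs _ hmem
      have hd : d (wordAt x (i - g) (Nat.find hex)) = Nat.find hex := by
        have := congrArg List.length hs₂
        rw [length_wordAt, length_wordAt] at this
        exact this.symm
      rw [hd] at hs₁ hs₂
      have := edgeAt_segmentGraph_end hgap hs₁ hr hs₂.symm
      rwa [sub_add_cancel] at this
    exact (Set.ncard_le_ncard hsub (hret.image _)).trans (Set.ncard_image_le hret)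
  have h₃ := Set.ncard_sdiff_singleton_add_one hg hfin
  have h₄ := Set.ncard_union_le S₁ S₂
  rw [hS]
  omega

/-- The trees are stars. A path not ending at the end of the segment has a forced next edge; one
that does, being shorter than `g`, lies in the segment and has a forced preceding edge. -/
theorem isTreeRel_segmentGraph [Finite A] (hL : g ≤ L) (hgap : HasGap x t L g)
    (hrec : IsRecurrent x t L N) {n : ℕ} (hn : n < g) (i : ℤ) :
    IsTreeRel (extRel (segmentGraph x t L g) (edgeAt x (segmentGraph x t L g)) n i) := by
  set f := segmentGraph x t L g with hf
  have hfin := finite_range_segmentGraph hgap hrec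
  rw [← hf] at hfin
  have hE := finite_range_edgeAt x hfin
  have hfinite : (extRel f (edgeAt x f) n i).Finite := by
    refine (hE.prod hE).subset ?_
    rintro _ ⟨j, -, rfl⟩
    exact ⟨⟨_, rfl⟩, ⟨_, rfl⟩⟩
  have hne : (extRel f (edgeAt x f) n i).Nonempty := ⟨_, i, ⟨rfl, fun _ _ => rfl⟩, rfl⟩
  have hend : ∀ j, SameWindow f (edgeAt x f) n i j → f (j + n) = f (i + n) := by
    intro j hj
    rcases n with _ | n
    · simpa using hj.1
    · have := (coherent_edgeAt x f _ _ (sameWindow_succ.1 hj).2).2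
      push_cast
      rwa [← add_assoc, ← add_assoc]
  by_cases hg : f (i + n) = Sum.inl g
  · obtain ⟨-, hocc⟩ := occ_of_segmentGraph_eq_inl hg
    have hi : f i = Sum.inl (g - n) := by
      refine segmentGraph_eq_inl hgap (by omega) ?_
      rw [Nat.cast_sub hn.le]
      convert hocc using 1
      ring
    have hleft : ∀ j, SameWindow f (edgeAt x f) n i j →
        edgeAt x f (j - 1) = (Sum.inl (g - n - 1), x (t + (g - n - 1 : ℕ)),
          Sum.inl (g - n - 1 + 1)) := by
      intro j hj
      obtain ⟨-, hj'⟩ := occ_of_segmentGraph_eq_inl (hj.1.trans hi)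
      refine edgeAt_segmentGraph_inl hL hgap (by omega) (segmentGraph_eq_inl hgap (by omega) ?_)
      convert hj' using 1
      omega
    refine isTreeRel_of_fst_eq hfinite hne ?_
    rintro _ ⟨j, hj, rfl⟩ _ ⟨l, hl, rfl⟩
    exact (hleft j hj).trans (hleft l hl).symm
  · refine isTreeRel_of_snd_eq hfinite hne ?_
    have hright : ∀ j, SameWindow f (edgeAt x f) n i j →
        edgeAt x f (j + n) = edgeAt x f (i + n) := by
      intro j hj
      have hji := hend j hj
      by_cases hk : ∃ k, f (i + n) = Sum.inl k
      · obtain ⟨k, hk⟩ := hk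
        have hkg : k < g := lt_of_le_of_ne (occ_of_segmentGraph_eq_inl hk).1
          fun h => hg (by rw [hk, h])
        rw [edgeAt_segmentGraph_inl hL hgap hkg hk,
          edgeAt_segmentGraph_inl hL hgap hkg (hji.trans hk)]
      · push Not at hk
        exact (edgeAt_segmentGraph_inr hgap hrec hk hji.symm).symm
    rintro _ ⟨j, hj, rfl⟩ _ ⟨l, hl, rfl⟩
    exact (hright j hj).trans (hright l hl).symm

end StartGraph

/-! ### The periodic case, and the main result for a single sequence. -/

section Periodicity

variable {A : Type*}

/-- Either some window of `x` reoccurs only after long times, or `x` is periodic. -/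
theorem exists_hasGap_or_periodic (x : ℤ → A) (g : ℕ) :
    (∃ t L, g ≤ L ∧ HasGap x t L g) ∨ ∃ d : ℕ, 0 < d ∧ Function.Periodic x d := by
  by_cases h : ∃ t L, g ≤ L ∧ HasGap x t L g
  · exact Or.inl h
  right
  push Not at h
  have key : ∀ m : ℕ, ∃ d ∈ {d : ℕ | 0 < d ∧ d ≤ g},
      ∀ i : ℤ, -m ≤ i → i ≤ m → x (i + d) = x i := by
    intro m
    -- This window contains `[-m, m]` and all its translates by at most `g`, so a return within time
    -- `g` yields a period on `[-m, m]`.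
    have := h (-m) (2 * m + 1 + g) (by omega)
    unfold HasGap at this
    push Not at this
    obtain ⟨s, d, hd, h₁, h₂, hdg⟩ := this
    refine ⟨d, ⟨hd, hdg⟩, fun i hi hi' => ?_⟩
    have k₁ := h₁ ((i + m).toNat + d) (by omega)
    have k₂ := h₂ (i + m).toNat (by omega)
    rw [Nat.cast_add, Int.toNat_of_nonneg (by omega)] at k₁
    rw [Int.toNat_of_nonneg (by omega)] at k₂
    calc x (i + d) = x (-m + (i + m + d)) := by congr 1; ring
      _ = x (s + (i + m + d)) := k₁.symm
      _ = x (s + d + (i + m)) := by congr 1; ring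
      _ = x (-m + (i + m)) := k₂
      _ = x i := by congr 1; ring
  obtain ⟨d, hd, hper⟩ := exists_forall_of_antitone
    ((Set.finite_le_nat g).subset fun d hd => hd.2)
    (P := fun m d => ∀ i : ℤ, -m ≤ i → i ≤ m → x (i + d) = x i)
    (fun m n s hmn h i hi hi' => h i (by omega) (by omega)) key
  exact ⟨d, hd.1, fun i => hper i.natAbs i (by omega) (by omega)⟩

/-- An occurrence of a full period determines the entire sequence seen from it, in particular the
time of the next occurrence. -/
theorem returnSet_subsingleton_of_periodic {x : ℤ → A} {d : ℕ} (hd : 0 < d)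
    (hx : Function.Periodic x d) : (returnSet x 0 d).Subsingleton := by
  have hocc : ∀ s, Occ x 0 d s → ∀ k : ℤ, x (s + k) = x k := by
    intro s hs k
    have h₀ : (0 : ℤ) ≤ k % d := Int.emod_nonneg _ (by omega)
    have h₁ : k % d < d := Int.emod_lt_of_pos _ (by omega)
    have h₂ : k = k % d + k / d * d := by rw [mul_comm, Int.emod_add_mul_ediv]
    have h₃ := hs (k % d).toNat (by omega)
    rw [Int.toNat_of_nonneg h₀, zero_add] at h₃
    have hp : Function.Periodic x (k / d * d) := by simpa using hx.int_mul (k / d)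
    rw [h₂, ← add_assoc, hp, hp, h₃]
  rintro _ ⟨s, n, hs, rfl⟩ _ ⟨s', n', hs', rfl⟩
  have h : ∀ k : ℤ, x (s + k) = x (s' + k) := fun k => by
    rw [hocc s hs.2.1, hocc s' hs'.2.1]
  have ho : ∀ k : ℤ, Occ x 0 d (s + k) ↔ Occ x 0 d (s' + k) := by
    intro k
    unfold Occ
    simp only [add_assoc, h]
  obtain rfl : n = n' := by
    rcases lt_trichotomy n n' with hlt | heq | hlt
    · exact absurd ((ho n).1 hs.2.2.1) (hs'.2.2.2 n hs.1 hlt)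
    · exact heq
    · exact absurd ((ho n').2 hs'.2.2.1) (hs.2.2.2 n' hs'.1 hlt)
  exact wordAt_eq_iff.2 fun k _ => h k

end Periodicity

/-- The extension graphs of the words of `x` are trees if all return sets of `x` are bases. -/
theorem isTreeRel_of_isBasis {A : Type*} [Finite A] {x : ℤ → A} (hx : Function.Surjective x)
    (hb : ∀ t L, IsBasis (toFreeGroup '' returnSet x t L))
    (hrec : ∀ t L, ∃ N, IsRecurrent x t L N) (n : ℕ) (i : ℤ) :
    IsTreeRel (extRel (fun _ => ()) x n i) := by
  have hcard : ∀ t L, (returnSet x t L).ncard = Nat.card A := fun t L => by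
    rw [← (hb t L).card_eq, Nat.card_coe_set_eq,
      Set.ncard_image_of_injective _ toFreeGroup_injective]
  have hpos : 0 < Nat.card A := Nat.card_pos_iff.2 ⟨⟨x 0⟩, inferInstance⟩
  rcases exists_hasGap_or_periodic x (n + 1) with ⟨t, L, hL, hgap⟩ | ⟨d, hd, hper⟩
  · obtain ⟨N, hN⟩ := hrec t L
    have hret : (returnSet x t L).Finite := Set.finite_of_ncard_pos (by rw [hcard]; exact hpos)
    have hle := ncard_range_edgeAt_segmentGraph hL hgap hN hret
    rw [hcard] at hle
    exact isTreeRel_of_graph hx hb (finite_range_segmentGraph hgap hN)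
      (isLocal_segmentGraph hgap hN) hle (fun n hn i => isTreeRel_segmentGraph hL hgap hN hn i)
      n (by omega) i
  · have hsub := returnSet_subsingleton_of_periodic hd hper
    have := hsub.finite.to_subtype
    have h₁ := Set.ncard_le_one_iff_subsingleton.2 hsub
    rw [hcard] at h₁
    -- One return word means rank at most one, so there is only one letter and a single edge.
    have : Subsingleton A := Finite.card_le_one_iff_subsingleton.1 h₁
    exact isTreeRel_of_fst_eq (Set.toFinite _) ⟨_, i, ⟨rfl, fun _ _ => rfl⟩, rfl⟩
      fun _ _ _ _ => Subsingleton.elim _ _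

/-! ### Splitting words; every letter occurs. -/

section WordsAndBases

variable {A : Type*}

theorem wordAt_add_eq_append {x : ℤ → A} {s : ℤ} {d d' : ℕ} {u v : List A} (hu : u.length = d)
    (h : wordAt x s (d + d') = u ++ v) : u = wordAt x s d ∧ v = wordAt x (s + d) d' := by
  rw [wordAt_add] at h
  obtain ⟨h₁, h₂⟩ := List.append_inj h (by rw [length_wordAt, hu])
  exact ⟨h₁.symm, h₂.symm⟩

/-- The exponent sum of a missing letter would vanish on all return words, hence on the group they
generate. -/
theorem surjective_of_isBasis {x : ℤ → A} {t : ℤ} {L : ℕ}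
    (hb : IsBasis (toFreeGroup '' returnSet x t L)) : Function.Surjective x := by
  classical
  intro a
  by_contra hcon
  push Not at hcon
  let ψ : FreeGroup A →* Multiplicative ℤ :=
    FreeGroup.lift fun b => if b = a then Multiplicative.ofAdd 1 else 1
  have h : FreeGroup.of a ∈ ψ.ker := by
    refine hb.mem_of_subset ?_ _
    rintro _ ⟨_, ⟨s, d, -, rfl⟩, rfl⟩
    refine Subgroup.list_prod_mem _ fun u hu => ?_
    rw [List.mem_map] at hu
    obtain ⟨b, hb, rfl⟩ := hu
    obtain ⟨k, rfl⟩ := (List.mem_ofFn' _ _).1 hb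
    simp [ψ, MonoidHom.mem_ker, hcon]
  rw [MonoidHom.mem_ker] at h
  simp [ψ] at h

end WordsAndBases

/-! ### From a minimal shift space to one of its points. -/

section Minimality

variable {A : Type*} [TopologicalSpace A]

/-- The closure of the orbit of `y`. -/
def orbitClosure (y : ℤ → A) : Subshift A ℤ where
  carrier := closure (Set.range fun g : ℤ => shift g y)
  isClosed := isClosed_closure
  mapsTo := fun g z hz => by
    refine map_mem_closure (continuous_shift g) hz ?_
    rintro _ ⟨h, rfl⟩
    exact ⟨h + g, by rw [← shift_add]⟩

theorem IsMinimal.mem_closure_orbit {X : Subshift A ℤ} (hX : IsMinimal X) {x y : ℤ → A}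
    (hx : x ∈ X.carrier) (hy : y ∈ X.carrier) :
    x ∈ closure (Set.range fun g : ℤ => shift g y) := by
  have h := hX.2 (orbitClosure y) ⟨y, subset_closure ⟨0, by funext k; simp [shift]⟩⟩
    (closure_minimal (by rintro _ ⟨g, rfl⟩; exact X.mapsTo g hy) X.isClosed)
  change x ∈ (orbitClosure y).carrier
  rwa [h]

variable [DiscreteTopology A]

theorem IsMinimal.exists_occurrence {X : Subshift A ℤ} (hX : IsMinimal X) {x y : ℤ → A}
    (hx : x ∈ X.carrier) (hy : y ∈ X.carrier) (t : ℤ) (L : ℕ) :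
    ∃ i : ℤ, ∀ k : ℕ, k < L → y (i + k) = x (t + k) := by
  have h := hX.mem_closure_orbit hx hy
  rw [mem_closure_iff] at h
  obtain ⟨_, hz, ⟨g, rfl⟩⟩ := h (cylinder (Finset.Ico t (t + L)) x) (isOpen_cylinder _ _)
    (fun _ _ => rfl)
  refine ⟨g + t, fun k hk => ?_⟩
  have := hz (t + k) (by simp; omega)
  rwa [add_assoc]

/-- By minimality, the open sets of points showing the word at position `i` cover the compact space;
a finite subcover bounds the waiting time. -/
theorem IsMinimal.isRecurrent [Finite A] {X : Subshift A ℤ} (hX : IsMinimal X) {x : ℤ → A}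
    (hx : x ∈ X.carrier) (t : ℤ) (L : ℕ) : ∃ N, IsRecurrent x t L N := by
  have hcomp : IsCompact X.carrier := X.isClosed.isCompact
  have hopen : ∀ i : ℤ, IsOpen {y : ℤ → A | ∀ k : ℕ, k < L → y (i + k) = x (t + k)} := by
    intro i
    have : {y : ℤ → A | ∀ k : ℕ, k < L → y (i + k) = x (t + k)} =
        ⋂ k ∈ Finset.range L, {y : ℤ → A | y (i + k) = x (t + k)} := by
      ext y
      simp
    rw [this]
    refine isOpen_biInter_finset fun k _ => ?_
    exact (isOpen_discrete ({x (t + k)} : Set A)).preimage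
      (continuous_apply (A := fun _ : ℤ => A) (i + (k : ℤ)))
  obtain ⟨F, hF⟩ := hcomp.elim_finite_subcover _ hopen
    (fun y hy => Set.mem_iUnion.2 (hX.exists_occurrence hx hy t L))
  let M := F.sup Int.natAbs
  -- Positions in `[-M, M]` are moved to `[0, 2M]` by the shift by `M`.
  refine ⟨2 * M, fun s => ?_⟩
  have hmem := hF (X.mapsTo (s + M) hx)
  simp only [Set.mem_iUnion] at hmem
  obtain ⟨i, hi, hocc⟩ := hmem
  have hiM : i.natAbs ≤ M := Finset.le_sup (f := Int.natAbs) hi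
  refine ⟨(M + i).toNat, by omega, fun k hk => ?_⟩
  have := hocc k hk
  rw [shift_apply] at this
  rw [Int.toNat_of_nonneg (by omega), ← this]
  congr 1
  ring

theorem IsMinimal.mem_language_iff {X : Subshift A ℤ} (hX : IsMinimal X) {x : ℤ → A}
    (hx : x ∈ X.carrier) {w : List A} : w ∈ language X ↔ ∃ t n, w = wordAt x t n := by
  constructor
  · rintro ⟨y, hy, i, n, rfl⟩
    obtain ⟨t, ht⟩ := hX.exists_occurrence hy hx i n
    exact ⟨t, n, congrArg List.ofFn (funext fun k => (ht k k.2).symm)⟩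
  · rintro ⟨t, n, rfl⟩
    exact ⟨x, hx, t, n, rfl⟩

/-- Once `r w` is located in `x`, the absence of inner occurrences of `w` says that its two end
occurrences are consecutive. -/
theorem IsMinimal.returnWords_eq {X : Subshift A ℤ} (hX : IsMinimal X) {x : ℤ → A}
    (hx : x ∈ X.carrier) (t : ℤ) (L : ℕ) :
    returnWords X (wordAt x t L) = returnSet x t L := by
  ext r
  constructor
  · rintro ⟨hr, hlang, ⟨u, hu⟩, hmid⟩
    obtain ⟨s, n, hw⟩ := (hX.mem_language_iff hx).1 hlang
    obtain rfl : n = r.length + L := by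
      have := congrArg List.length hw
      simpa [length_wordAt] using this.symm
    obtain ⟨h₁, h₂⟩ := wordAt_add_eq_append rfl hw.symm
    have h₃ : wordAt x t L = wordAt x s L := by
      refine (wordAt_add_eq_append (d' := r.length) (v := u) (length_wordAt _ _ _) ?_).1
      rw [add_comm, ← hw, hu]
    refine ⟨s, r.length, ⟨List.length_pos_iff.2 hr, wordAt_eq_iff.1 h₃.symm,
      wordAt_eq_iff.1 h₂.symm, fun k hk hkr hocc => hmid ?_⟩, h₁⟩
    obtain ⟨m, hm⟩ := Nat.exists_eq_add_of_lt hkr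
    refine ⟨wordAt x s k, wordAt x (s + (k + L : ℕ)) (m + 1), ?_, ?_, ?_⟩
    · rw [← List.length_pos_iff, length_wordAt]
      exact hk
    · rw [← List.length_pos_iff, length_wordAt]
      omega
    · rw [hw, ← wordAt_eq_iff.2 hocc, ← wordAt_add, ← wordAt_add]
      congr 1
      omega
  · rintro ⟨s, d, ⟨hd, hs, hsd, hmin⟩, rfl⟩
    have hw : wordAt x s d ++ wordAt x t L = wordAt x s (d + L) := by
      rw [wordAt_add, wordAt_eq_iff.2 hsd]
    refine ⟨?_, ?_, ⟨wordAt x (s + L) d, ?_⟩, ?_⟩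
    · rw [← List.length_pos_iff, length_wordAt]
      exact hd
    · rw [hw]
      exact (hX.mem_language_iff hx).2 ⟨_, _, rfl⟩
    · rw [hw, add_comm, wordAt_add, wordAt_eq_iff.2 hs]
    · rintro ⟨p, u, hp, hu, h⟩
      rw [hw] at h
      have hlen := congrArg List.length h
      simp only [length_wordAt, List.length_append] at hlen
      have hp' := List.length_pos_iff.2 hp
      have hu' := List.length_pos_iff.2 hu
      have e : d + L = p.length + (L + u.length) := by omega
      rw [e, List.append_assoc] at h
      obtain ⟨-, h₂⟩ := wordAt_add_eq_append rfl h
      obtain ⟨h₃, -⟩ := wordAt_add_eq_append (length_wordAt _ _ _) h₂.symm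
      exact hmin p.length hp' (by omega) (wordAt_eq_iff.1 h₃.symm)

theorem IsMinimal.biExt_eq {X : Subshift A ℤ} (hX : IsMinimal X) {x : ℤ → A}
    (hx : x ∈ X.carrier) (i : ℤ) (n : ℕ) :
    biExt X (wordAt x i n) = extRel (fun _ => ()) x n i := by
  have h₁ : ∀ j, [x j] = wordAt x j 1 := fun j => by simp [wordAt]
  ext ⟨a, b⟩
  constructor
  · intro h
    obtain ⟨s, m, hw⟩ := (hX.mem_language_iff hx).1 h
    change [a] ++ (wordAt x i n ++ [b]) = wordAt x s m at hw
    obtain rfl : m = 1 + (n + 1) := by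
      have := congrArg List.length hw
      simp only [length_wordAt, List.length_append, List.length_singleton] at this
      exact this.symm
    obtain ⟨h₂, h₃⟩ := wordAt_add_eq_append (by simp) hw.symm
    obtain ⟨h₄, h₅⟩ := wordAt_add_eq_append (length_wordAt _ _ _) h₃.symm
    rw [← h₁, List.singleton_inj] at h₂ h₅
    refine ⟨s + 1, ⟨rfl, wordAt_eq_iff.1 h₄.symm⟩, ?_⟩
    rw [h₂, h₅]
    simp
  · rintro ⟨j, hj, h⟩
    rw [Prod.mk.injEq] at h
    refine (hX.mem_language_iff hx).2 ⟨j - 1, 1 + (n + 1), ?_⟩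
    rw [wordAt_add, wordAt_add, ← h₁, ← h₁, h.1, h.2]
    simp only [Nat.cast_one, sub_add_cancel, wordAt_eq_iff.2 hj.2]
    rfl

/-- Points are bi-infinite, so `a w` always continues to the right; no vertex of the extension graph
is isolated. -/
theorem IsMinimal.fst_image_biExt {X : Subshift A ℤ} (hX : IsMinimal X) {x : ℤ → A}
    (hx : x ∈ X.carrier) (w : List A) : Prod.fst '' biExt X w = leftExt X w := by
  ext a
  constructor
  · rintro ⟨⟨a, b⟩, h, rfl⟩
    obtain ⟨s, m, hw⟩ := (hX.mem_language_iff hx).1 h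
    change (a :: w) ++ [b] = _ at hw
    refine (hX.mem_language_iff hx).2 ⟨s, (a :: w).length, ?_⟩
    refine (wordAt_add_eq_append (d' := 1) (v := [b]) rfl ?_).1
    rw [hw]
    congr 1
    have := congrArg List.length hw
    rw [length_wordAt] at this
    simpa using this
  · intro h
    obtain ⟨s, m, hw⟩ := (hX.mem_language_iff hx).1 h
    refine ⟨(a, x (s + m)), (hX.mem_language_iff hx).2 ⟨s, m + 1, ?_⟩, rfl⟩
    rw [wordAt_add, ← hw]
    simp [wordAt]

theorem IsMinimal.snd_image_biExt {X : Subshift A ℤ} (hX : IsMinimal X) {x : ℤ → A}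
    (hx : x ∈ X.carrier) (w : List A) : Prod.snd '' biExt X w = rightExt X w := by
  ext b
  constructor
  · rintro ⟨⟨a, b⟩, h, rfl⟩
    obtain ⟨s, m, hw⟩ := (hX.mem_language_iff hx).1 h
    change [a] ++ (w ++ [b]) = _ at hw
    refine (hX.mem_language_iff hx).2 ⟨s + (1 : ℕ), (w ++ [b]).length, ?_⟩
    refine (wordAt_add_eq_append (u := [a]) rfl ?_).2
    rw [hw]
    congr 1
    have := congrArg List.length hw
    rw [length_wordAt] at this
    simpa [add_comm] using this
  · intro h
    obtain ⟨s, m, hw⟩ := (hX.mem_language_iff hx).1 h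
    refine ⟨(x (s - 1), b), (hX.mem_language_iff hx).2 ⟨s - 1, 1 + m, ?_⟩, rfl⟩
    rw [wordAt_add]
    simp only [Nat.cast_one, sub_add_cancel, ← hw]
    simp [wordAt]

end Minimality

end ShiftSpace

theorem theorem2 {A : Type*} [Finite A] [TopologicalSpace A] [DiscreteTopology A]
    (X : Subshift A ℤ) (hX : ShiftSpace.IsMinimal X)
    (hbasis : ∀ w ∈ ShiftSpace.language X,
      ShiftSpace.IsBasis (ShiftSpace.toFreeGroup '' ShiftSpace.returnWords X w)) :
    ShiftSpace.IsDendric X := by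
  obtain ⟨x, hx⟩ := hX.1
  have hb : ∀ t L, ShiftSpace.IsBasis (ShiftSpace.toFreeGroup '' ShiftSpace.returnSet x t L) := by
    intro t L
    rw [← hX.returnWords_eq hx]
    exact hbasis _ ((hX.mem_language_iff hx).2 ⟨t, L, rfl⟩)
  intro w hw
  obtain ⟨i, n, rfl⟩ := (hX.mem_language_iff hx).1 hw
  have htree := ShiftSpace.isTreeRel_of_isBasis (ShiftSpace.surjective_of_isBasis (hb 0 0)) hb
    (hX.isRecurrent hx) n i
  rw [← hX.biExt_eq hx] at htree
  -- `extensionGraph` is by definition the `bipartiteGraph` of `biExt`.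
  exact htree.isTree (hX.fst_image_biExt hx _) (hX.snd_image_biExt hx _)
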